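/- Let $N\ge 1$ and let $M\subset\mathbb{CP}^N$ be a closed (compact, without boundary) embedded real hypersurface of class $C^h$, $h\ge 2$, with inclusion $j$. For $x\in M$ let $D_x=T_xM\cap iT_xM$ be the complex tangent space, and let $\nu\colon M\to\mathbb{CP}^{N*}$ be the dual map, which sends $x$ to the projective hyperplane through $x$ with tangent space $D_x$ at $x$. Assume that $M$ has immersed dual set, i.e. that $\nu$ is an immersion, and put $M^*=\nu(M)$. Let $H_0,H_1$ be linearly independent linear forms on $\mathbb{C}^{N+1}$, let $L\subset\mathbb{CP}^{N*}$ be the line of hyperplanes $\lambda H_0+\mu H_1=0$, let $\tilde B=\{H_0=H_1=0\}$, $B=\tilde B\cap M$, let $\Phi=[H_0:H_1]\colon\mathbb{CP}^N\setminus\tilde B\to\mathbb{CP}^1$, and let $\phi_L\colon M\setminus B\to\mathbb{CP}^1$ be its restriction. We say that $\phi_L$ defines a CR Lefschetz pencil structure on $M$ if any two distinct hyperplanes of $L$ intersect transversely, with intersection $\tilde B$, and 1. $\tilde B$ is transverse to $M$; 2. the CR 1-jet $j^1_D\phi_L=(\phi_L,d\phi_L|_D)$, a section over $M\setminus B$ of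 the bundle $\mathcal J^1_D(M,\mathbb{CP}^1)$ with fibre $\{(y,h): y\in\mathbb{CP}^1,\ h\in\mathrm{Hom}_{\mathbb C}(D_x,T_y\mathbb{CP}^1)\}$ over $x$, is transverse along $D$ to $\Sigma=\{h=0\}$; 3. with $TM^J$ the complex subbundle of $T\mathbb{CP}^N|_M$ spanned by $TM$, the 1-jet $(\Phi,d\Phi|_{TM^J})$, a section over $M\setminus B$ of the bundle with fibre $\{(y,h): y\in\mathbb{CP}^1,\ h\in\mathrm{Hom}_{\mathbb C}(TM^J_x,T_y\mathbb{CP}^1)\}$ over $x$, is transverse along $TM$ to $\{h=0\}$. Here a section $\sigma$ is transverse along a distribution $K\subset TM$ to a submanifold $S$ of a bundle over $M$ if, whenever $\sigma(x)\in S$, the preimage $\hat K$ of $K_x$ in the tangent space of the bundle at $\sigma(x)$ is spanned by $T_{\sigma(x)}S\cap\hat K$ and $d\sigma(T_xM)\cap\hat K$. Then $\phi_L$ defines a CR Lefschetz pencil structure on $M$ if and only if $L$ meets $M^*$ transversely along all its branches, that is, $T_{x^*}L+d\nu(T_xM)=T_{x^*}\mathbb{CP}^{N*}$ for every $x^*\in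 L\cap M^*$ and every $x\in M$ with $\nu(x)=x^*$. -/

import Mathlib

open Topology
open scoped Manifold ContDiff LinearAlgebra.Projectivization Topology

noncomputable section

/-! ### Complex projective space as a manifold -/

/-- Complex projective space, the set of lines of `ℂ ^ (N + 1)`. -/
abbrev CP (N : ℕ) : Type := ℙ ℂ (Fin (N + 1) → ℂ)

namespace CP

variable {N : ℕ}

/-- The projection `v ↦ [v]` (with a junk value at `0`). -/
def mk (v : Fin (N + 1) → ℂ) : CP N :=
  if h : v ≠ 0 then Projectivization.mk ℂ v h else Projectivization.mk ℂ (fun _ => 1)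
    (fun h => one_ne_zero (congrFun h 0))

/-- The quotient topology. -/
instance : TopologicalSpace (CP N) :=
  inferInstanceAs (TopologicalSpace
    (Quotient (projectivizationSetoid ℂ (Fin (N + 1) → ℂ))))

/-- The affine coordinates `z k / z i`, `k ≠ i`. -/
def coord (i : Fin (N + 1)) (x : CP N) : Fin N → ℂ :=
  fun k => x.rep (i.succAbove k) / x.rep i

lemma rep_mk' (v : {v : Fin (N + 1) → ℂ // v ≠ 0}) :
    ∃ a : ℂ, a ≠ 0 ∧ (Projectivization.mk' ℂ v).rep = a • (v : Fin (N + 1) → ℂ) := by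
  obtain ⟨a, ha⟩ := Projectivization.exists_smul_eq_mk_rep ℂ v.1 v.2
  exact ⟨a, a.ne_zero, by rw [Projectivization.mk'_eq_mk, ← ha]; rfl⟩

lemma coord_mk' (i : Fin (N + 1)) (v : {v : Fin (N + 1) → ℂ // v ≠ 0}) :
    coord i (Projectivization.mk' ℂ v) = fun k => v.1 (i.succAbove k) / v.1 i := by
  obtain ⟨a, ha, h⟩ := rep_mk' v
  funext k
  simp only [coord, h, Pi.smul_apply, smul_eq_mul]
  exact mul_div_mul_left _ _ ha

lemma isQuotientMap_mk' :
    IsQuotientMap (Projectivization.mk' ℂ : {v : Fin (N + 1) → ℂ // v ≠ 0} → CP N) :=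
  isQuotientMap_quotient_mk'

lemma preimage_source (i : Fin (N + 1)) :
    (Projectivization.mk' ℂ : {v : Fin (N + 1) → ℂ // v ≠ 0} → CP N) ⁻¹' {x | x.rep i ≠ 0} =
      {v | v.1 i ≠ 0} := by
  ext v
  obtain ⟨a, ha, h⟩ := rep_mk' v
  change (Projectivization.mk' ℂ v).rep i ≠ 0 ↔ v.1 i ≠ 0
  rw [h]
  exact not_congr (by simp [ha])

lemma isOpen_source (i : Fin (N + 1)) : IsOpen {x : CP N | x.rep i ≠ 0} := by
  rw [← isQuotientMap_mk'.isOpen_preimage, preimage_source]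
  exact isOpen_ne_fun ((continuous_apply i).comp continuous_subtype_val) continuous_const

lemma insertNth_ne_zero (i : Fin (N + 1)) (w : Fin N → ℂ) :
    (i.insertNth (1 : ℂ) w : Fin (N + 1) → ℂ) ≠ 0 := by
  intro h
  have := congrFun h i
  simp at this

/-- The inverse of the affine coordinates. -/
def affineInv (i : Fin (N + 1)) (w : Fin N → ℂ) : CP N :=
  Projectivization.mk' ℂ ⟨i.insertNth (1 : ℂ) w, insertNth_ne_zero i w⟩

/-- The affine chart on `{z i ≠ 0}`. -/
def affineChart (i : Fin (N + 1)) : OpenPartialHomeomorph (CP N) (Fin N → ℂ) where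
  toFun := coord i
  invFun := affineInv i
  source := {x | x.rep i ≠ 0}
  target := Set.univ
  map_source' _ _ := Set.mem_univ _
  map_target' w _ := by
    have : (⟨i.insertNth (1 : ℂ) w, insertNth_ne_zero i w⟩ :
      {v : Fin (N + 1) → ℂ // v ≠ 0}) ∈ {v | v.1 i ≠ 0} := by simp
    rwa [← preimage_source] at this
  left_inv' x hx := by
    replace hx : x.rep i ≠ 0 := hx
    conv_rhs => rw [← Projectivization.mk_rep x]
    refine (Projectivization.mk_eq_mk_iff' ℂ _ _ _ _).2 ⟨(x.rep i)⁻¹, ?_⟩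
    funext k
    refine Fin.succAboveCases i ?_ (fun k => ?_) k
    · simp [hx]
    · simp [coord, div_eq_inv_mul]
  right_inv' w _ := by
    rw [affineInv, coord_mk']
    funext k
    simp
  open_source := isOpen_source i
  open_target := isOpen_univ
  continuousOn_toFun := by
    rw [isQuotientMap_mk'.continuousOn_isOpen_iff (isOpen_source i), preimage_source]
    have : coord i ∘ (Projectivization.mk' ℂ : {v : Fin (N + 1) → ℂ // v ≠ 0} → CP N) =
      fun v k => v.1 (i.succAbove k) / v.1 i := funext (coord_mk' i)
    rw [this]
    have hc : ∀ l, Continuous fun v : {v : Fin (N + 1) → ℂ // v ≠ 0} => v.1 l := fun l =>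
      (continuous_apply l).comp continuous_subtype_val
    exact continuousOn_pi.2 fun k => (hc _).continuousOn.div (hc _).continuousOn fun v hv => hv
  continuousOn_invFun := by
    refine Continuous.continuousOn (isQuotientMap_mk'.continuous.comp (Continuous.subtype_mk ?_ _))
    fun_prop

lemma exists_rep_ne_zero (x : CP N) : ∃ i, x.rep i ≠ 0 := by
  by_contra! h
  exact x.rep_nonzero (funext h)

instance : ChartedSpace (Fin N → ℂ) (CP N) where
  atlas := Set.range affineChart
  chartAt x := affineChart (exists_rep_ne_zero x).choose
  mem_chart_source x := (exists_rep_ne_zero x).choose_spec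
  chart_mem_atlas _ := ⟨_, rfl⟩

lemma contDiffOn_transition (𝕜 : Type) [NontriviallyNormedField 𝕜] [NormedAlgebra 𝕜 ℂ]
    (i j : Fin (N + 1)) :
    ContDiffOn 𝕜 ω ((affineChart i).symm ≫ₕ affineChart j)
      ((affineChart i).symm ≫ₕ affineChart j).source := by
  have h1 : ∀ w, ((affineChart i).symm ≫ₕ affineChart j) w = fun k =>
      (i.insertNth (1 : ℂ) w : Fin (N + 1) → ℂ) (j.succAbove k) /
        (i.insertNth (1 : ℂ) w : Fin (N + 1) → ℂ) j := fun w => coord_mk' j _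
  have h2 : ∀ l, ContDiff 𝕜 ω
      (fun w : Fin N → ℂ => (i.insertNth (1 : ℂ) w : Fin (N + 1) → ℂ) l) := by
    intro l
    refine Fin.succAboveCases i ?_ (fun k => ?_) l
    · simpa using contDiff_const
    · simpa using contDiff_apply 𝕜 ℂ k
  refine (contDiffOn_pi.2 fun k => ?_).congr fun w _ => h1 w
  simp only [div_eq_mul_inv]
  refine (h2 (j.succAbove k)).contDiffOn.mul ((h2 j).contDiffOn.inv fun w hw => ?_)
  have hw' : affineInv i w ∈ {x : CP N | x.rep j ≠ 0} := hw.2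
  have := (Set.ext_iff.1 (preimage_source j) ⟨_, insertNth_ne_zero i w⟩).1 hw'
  exact this

instance : IsManifold 𝓘(ℂ, Fin N → ℂ) ω (CP N) := by
  refine isManifold_of_contDiffOn _ _ _ ?_
  rintro _ _ ⟨i, rfl⟩ ⟨j, rfl⟩
  simpa using contDiffOn_transition ℂ i j

instance : IsManifold 𝓘(ℝ, Fin N → ℂ) ω (CP N) := by
  refine isManifold_of_contDiffOn _ _ _ ?_
  rintro _ _ ⟨i, rfl⟩ ⟨j, rfl⟩
  simpa using contDiffOn_transition ℝ i j

/-! ### Linear subspaces of projective space -/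

/-- The linear form `z ↦ ∑ i, a i * z i`. -/
def linForm (a : Fin (N + 1) → ℂ) : (Fin (N + 1) → ℂ) →ₗ[ℂ] ℂ :=
  ∑ i, a i • LinearMap.proj i

/-- The projective linear subspace `ℙ(S)` of `CP N` defined by a linear subspace `S` of
`ℂ ^ (N + 1)`. -/
def linSubspace (S : Submodule ℂ (Fin (N + 1) → ℂ)) : Set (CP N) := {x | x.rep ∈ S}

/-- The differential at the representative `x.rep` of the projection
`ℂ ^ (N + 1) \ {0} → CP N`, with values in the tangent space of `CP N` at `x`. -/
def dmk (x : CP N) : (Fin (N + 1) → ℂ) →L[ℂ] (Fin N → ℂ) :=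
  mfderiv 𝓘(ℂ, Fin (N + 1) → ℂ) 𝓘(ℂ, Fin N → ℂ) (mk : (Fin (N + 1) → ℂ) → CP N) x.rep

/-- The tangent space of `ℙ(S)` at a point `x ∈ ℙ(S)`, as a subspace of the tangent space
of `CP N` at `x`. -/
def tangentLin (S : Submodule ℂ (Fin (N + 1) → ℂ)) (x : CP N) : Submodule ℂ (Fin N → ℂ) :=
  S.map (dmk x).toLinearMap

/-- The dual projective space `CP N *` is identified with `CP N` by dual homogeneous coordinates:
the point `a` corresponds to the hyperplane `{z | ∑ i, a i * z i = 0}`. -/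
def hyperplane (a : CP N) : Submodule ℂ (Fin (N + 1) → ℂ) := LinearMap.ker (linForm a.rep)

lemma mk_of_ne {v : Fin (N + 1) → ℂ} (h : v ≠ 0) : mk v = Projectivization.mk' ℂ ⟨v, h⟩ :=
  dif_pos h

lemma mk_rep (x : CP N) : mk x.rep = x :=
  (dif_pos x.rep_nonzero).trans (Projectivization.mk_rep x)

lemma affineInv_coord (i : Fin (N + 1)) {v : Fin (N + 1) → ℂ} (hv : v i ≠ 0) :
    mk v = (affineChart i).symm fun k => v (i.succAbove k) / v i := by
  have h0 : v ≠ 0 := fun h => hv (by rw [h]; rfl)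
  rw [mk_of_ne h0]
  refine (Projectivization.mk_eq_mk_iff' ℂ _ _ _ _).2 ⟨v i, ?_⟩
  funext k
  refine Fin.succAboveCases i ?_ (fun k => ?_) k
  · simp
  · simp only [Pi.smul_apply, Fin.insertNth_apply_succAbove, smul_eq_mul]
    exact mul_div_cancel₀ _ hv

lemma mdifferentiableAt_mk {v : Fin (N + 1) → ℂ} (hv : v ≠ 0) :
    MDifferentiableAt 𝓘(ℂ, Fin (N + 1) → ℂ) 𝓘(ℂ, Fin N → ℂ)
      (mk : (Fin (N + 1) → ℂ) → CP N) v := by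
  obtain ⟨i, hi⟩ : ∃ i, v i ≠ 0 := Function.ne_iff.1 hv
  have h1 : MDifferentiableAt 𝓘(ℂ, Fin (N + 1) → ℂ) 𝓘(ℂ, Fin N → ℂ)
      (fun v : Fin (N + 1) → ℂ => fun k => v (i.succAbove k) / v i) v := by
    apply DifferentiableAt.mdifferentiableAt
    simp only [div_eq_mul_inv]
    exact differentiableAt_pi.2 fun k => DifferentiableAt.fun_mul (by fun_prop)
      (DifferentiableAt.fun_inv (by fun_prop) hi)
  have h2 : MDifferentiableAt 𝓘(ℂ, Fin N → ℂ) 𝓘(ℂ, Fin N → ℂ) (affineChart i).symm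
      (fun k => v (i.succAbove k) / v i) :=
    mdifferentiableAt_atlas_symm (Set.mem_range_self i) (Set.mem_univ _)
  refine (h2.comp v h1).congr_of_eventuallyEq ?_
  have : ∀ᶠ w : Fin (N + 1) → ℂ in 𝓝 v, w i ≠ 0 := (continuous_apply i).continuousAt.eventually_ne hi
  filter_upwards [this] with w hw using affineInv_coord i hw

lemma dmk_surjective (x : CP N) : Function.Surjective (dmk x) := by
  obtain ⟨i, hi⟩ := exists_rep_ne_zero x
  have hx : x ∈ (affineChart i).source := hi
  let s : CP N → (Fin (N + 1) → ℂ) := fun y => x.rep i • i.insertNth (1 : ℂ) (coord i y)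
  have hsx : s x = x.rep := by
    funext k
    refine Fin.succAboveCases i ?_ (fun k => ?_) k
    · simp [s]
    · simp only [s, coord, Pi.smul_apply, Fin.insertNth_apply_succAbove, smul_eq_mul]
      exact mul_div_cancel₀ _ hi
  have hs : MDifferentiableAt 𝓘(ℂ, Fin N → ℂ) 𝓘(ℂ, Fin (N + 1) → ℂ) s x := by
    have h1 : MDifferentiableAt 𝓘(ℂ, Fin N → ℂ) 𝓘(ℂ, Fin N → ℂ) (coord i) x :=
      mdifferentiableAt_atlas (e := affineChart i) (Set.mem_range_self i) hx
    have h2 : MDifferentiableAt 𝓘(ℂ, Fin N → ℂ) 𝓘(ℂ, Fin (N + 1) → ℂ)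
        (fun w : Fin N → ℂ => x.rep i • (i.insertNth (1 : ℂ) w : Fin (N + 1) → ℂ))
        (coord i x) := by
      apply DifferentiableAt.mdifferentiableAt
      refine differentiableAt_pi.2 fun l => DifferentiableAt.const_mul (𝕜 := ℂ)
        (a := fun w : Fin N → ℂ => (i.insertNth (1 : ℂ) w : Fin (N + 1) → ℂ) l) ?_ _
      refine Fin.succAboveCases i ?_ (fun k => ?_) l
      · simp
      · simp only [Fin.insertNth_apply_succAbove]
        fun_prop
    exact h2.comp x h1
  have hm : MDifferentiableAt 𝓘(ℂ, Fin (N + 1) → ℂ) 𝓘(ℂ, Fin N → ℂ)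
      (mk : (Fin (N + 1) → ℂ) → CP N) (s x) := mdifferentiableAt_mk (hsx ▸ x.rep_nonzero)
  have hid : (mk ∘ s : CP N → CP N) =ᶠ[𝓝 x] id := by
    filter_upwards [(affineChart i).open_source.mem_nhds hx] with y hy
    have h1 : (s y) i ≠ 0 := by simpa [s] using hi
    change mk (s y) = y
    rw [affineInv_coord i h1]
    conv_rhs => rw [← (affineChart i).left_inv hy]
    congr 1
    funext k
    change _ = coord i y k
    simp only [s, Pi.smul_apply, Fin.insertNth_apply_succAbove, Fin.insertNth_apply_same,
      smul_eq_mul, mul_one]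
    exact mul_div_cancel_left₀ _ hi
  have hc := mfderiv_comp x hm hs
  rw [hid.mfderiv_eq, mfderiv_id, hsx] at hc
  intro w
  exact ⟨_, (DFunLike.congr_fun hc w).symm⟩

lemma dmk_rep (x : CP N) : dmk x x.rep = 0 := by
  let c : ℂ → (Fin (N + 1) → ℂ) := fun t => t • x.rep
  have hc1 : c 1 = x.rep := one_smul _ _
  have hd : HasFDerivAt c ((1 : ℂ →L[ℂ] ℂ).smulRight x.rep) 1 :=
    (hasFDerivAt_id (1 : ℂ)).smul_const x.rep
  have hc : MDifferentiableAt 𝓘(ℂ, ℂ) 𝓘(ℂ, Fin (N + 1) → ℂ) c 1 :=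
    hd.differentiableAt.mdifferentiableAt
  have hm : MDifferentiableAt 𝓘(ℂ, Fin (N + 1) → ℂ) 𝓘(ℂ, Fin N → ℂ)
      (mk : (Fin (N + 1) → ℂ) → CP N) (c 1) := mdifferentiableAt_mk (hc1 ▸ x.rep_nonzero)
  have hid : (mk ∘ c : ℂ → CP N) =ᶠ[𝓝 1] fun _ => x := by
    filter_upwards [isOpen_ne.mem_nhds (one_ne_zero : (1 : ℂ) ≠ 0)] with t ht
    change mk (t • x.rep) = x
    have h0 : t • x.rep ≠ 0 := smul_ne_zero ht x.rep_nonzero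
    rw [mk_of_ne h0]
    conv_rhs => rw [← Projectivization.mk_rep x]
    exact (Projectivization.mk_eq_mk_iff' ℂ _ _ _ _).2 ⟨t, rfl⟩
  have h := mfderiv_comp (1 : ℂ) hm hc
  rw [hid.mfderiv_eq, mfderiv_const, mfderiv_eq_fderiv, hd.fderiv, hc1] at h
  have h' := DFunLike.congr_fun h (1 : ℂ)
  have h'' : (0 : Fin N → ℂ) = dmk x ((1 : ℂ) • x.rep) := h'
  rw [one_smul] at h''
  exact h''.symm

lemma ker_dmk (x : CP N) : LinearMap.ker (dmk x).toLinearMap = Submodule.span ℂ {x.rep} := by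
  symm
  apply Submodule.eq_of_le_of_finrank_eq
  · rw [Submodule.span_singleton_le_iff_mem]
    exact dmk_rep x
  · have h := LinearMap.finrank_range_add_finrank_ker (dmk x).toLinearMap
    rw [LinearMap.range_eq_top.2 (dmk_surjective x), finrank_top] at h
    simp only [Module.finrank_fintype_fun_eq_card, Fintype.card_fin] at h
    rw [finrank_span_singleton x.rep_nonzero]
    omega

lemma linForm_apply (a z : Fin (N + 1) → ℂ) : linForm a z = ∑ i, a i * z i := by
  simp [linForm]

lemma mem_hyperplane_mk {a : Fin (N + 1) → ℂ} (ha : a ≠ 0) (z : Fin (N + 1) → ℂ) :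
    z ∈ hyperplane (mk a) ↔ ∑ i, a i * z i = 0 := by
  obtain ⟨c, hc, h⟩ := rep_mk' ⟨a, ha⟩
  rw [hyperplane, LinearMap.mem_ker, linForm_apply, mk_of_ne ha, h]
  simp [mul_assoc, ← Finset.mul_sum, hc]

lemma eq_of_hyperplane_eq {a b : CP N} (h : hyperplane a = hyperplane b) : a = b := by
  have h' : LinearMap.ker (linForm b.rep) ≤ LinearMap.ker (linForm a.rep) := h.ge
  obtain ⟨c, hc⟩ : ∃ c : ℂ, linForm a.rep = c • linForm b.rep := by
    have := mem_span_of_iInf_ker_le_ker (ι := Unit) (L := fun _ => linForm b.rep)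
      (K := linForm a.rep) (by simpa using h')
    simpa [Submodule.mem_span_singleton, eq_comm] using this
  rw [← Projectivization.mk_rep a, ← Projectivization.mk_rep b]
  refine (Projectivization.mk_eq_mk_iff' ℂ _ _ _ _).2 ⟨c, ?_⟩
  funext i
  have := DFunLike.congr_fun hc (Pi.single i 1)
  simpa [linForm_apply, Pi.single_apply] using this.symm

end CP

/-! ### Real hypersurfaces of projective space -/

namespace CRPencil

section Maps

variable (d : ℕ) {N : ℕ} {M : Type*} [TopologicalSpace M] [ChartedSpace (EuclideanSpace ℝ (Fin d)) M]

/-- The differential at `x` of a map from a real manifold to `CP N`. -/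
def diff (f : M → CP N) (x : M) : EuclideanSpace ℝ (Fin d) →L[ℝ] (Fin N → ℂ) :=
  mfderiv (𝓡 d) 𝓘(ℝ, Fin N → ℂ) f x

/-- The image of the differential of `f` at `x`. For an immersion `f` this is the tangent space at
`f x` of the branch of the image of `f` parametrized by a neighbourhood of `x`. -/
def realTangent (f : M → CP N) (x : M) : Submodule ℝ (Fin N → ℂ) :=
  LinearMap.range (diff d f x).toLinearMap

/-- The complex envelope of the tangent space: the smallest complex subspace containing it. -/
def complexEnvelope (f : M → CP N) (x : M) : Submodule ℂ (Fin N → ℂ) :=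
  Submodule.span ℂ (realTangent d f x : Set (Fin N → ℂ))

/-- The complex tangent space `T ∩ i T`, where `T` is the tangent space of the image. -/
def complexTangent (f : M → CP N) (x : M) : Submodule ℂ (Fin N → ℂ) where
  carrier := {w | w ∈ realTangent d f x ∧ Complex.I • w ∈ realTangent d f x}
  add_mem' := fun ha hb => ⟨add_mem ha.1 hb.1, by rw [smul_add]; exact add_mem ha.2 hb.2⟩
  zero_mem' := ⟨zero_mem _, by rw [smul_zero]; exact zero_mem _⟩
  smul_mem' := by
    rintro c w ⟨h1, h2⟩
    have e1 : c • w = c.re • w + c.im • (Complex.I • w) := by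
      conv_lhs => rw [← Complex.re_add_im c]
      rw [add_smul, mul_smul, Complex.coe_smul, Complex.coe_smul]
    have e2 : Complex.I • c • w = c.re • (Complex.I • w) - c.im • w := by
      rw [e1, smul_add, smul_comm Complex.I c.re, smul_comm Complex.I c.im, smul_smul Complex.I,
        Complex.I_mul_I, neg_one_smul, smul_neg, sub_eq_add_neg]
    refine ⟨?_, ?_⟩
    · rw [e1]
      exact add_mem (Submodule.smul_mem _ _ h1) (Submodule.smul_mem _ _ h2)
    · rw [e2]
      exact sub_mem (Submodule.smul_mem _ _ h2) (Submodule.smul_mem _ _ h1)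

/-- The complex tangent space as a subspace of the tangent space of the manifold: the fibre at `x`
of the CR distribution `D`. -/
def crDistribution (f : M → CP N) (x : M) : Submodule ℝ (EuclideanSpace ℝ (Fin d)) :=
  ((complexTangent d f x).restrictScalars ℝ).comap (diff d f x).toLinearMap

end Maps

/-! ### Transversality of jets -/

section Jets

variable (d : ℕ) {N k : ℕ} {M : Type*} [TopologicalSpace M]
  [ChartedSpace (EuclideanSpace ℝ (Fin d)) M]

/-- `e` is a local frame of class `C ^ 1`, near `x`, of the complex subbundle `W` of the pull back
by `j` of the tangent bundle of `CP N`. -/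
structure IsComplexFrameAt (j : M → CP N) (W : M → Submodule ℂ (Fin N → ℂ))
    (e : Fin k → M → (Fin N → ℂ)) (x : M) : Prop where
  contMDiffAt : ∀ i, ContMDiffAt (𝓡 d) (𝓘(ℝ, Fin N → ℂ).prod 𝓘(ℝ, Fin N → ℂ)) 1
    (fun y => (⟨j y, e i y⟩ : TangentBundle 𝓘(ℝ, Fin N → ℂ) (CP N))) x
  linearIndependent : ∀ᶠ y in 𝓝 x, LinearIndependent ℂ (fun i => e i y)
  span_eq : ∀ᶠ y in 𝓝 x, Submodule.span ℂ (Set.range fun i => e i y) = W y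

/-- Let `W` be a complex vector bundle over `M` with a local frame `e` near `x`. The frame, together
with the trivialization of the tangent bundle of `CP 1` near `φ x`, identifies the bundle over `M`
with fibres `{(z, h) | z ∈ CP 1, h : W y → T_z CP 1 complex linear}` over a neighbourhood of
`(x, φ x)` with `M × CP 1 × (Fin k → ℂ)`, by sending `h` to the components of the `h (e i)`.
This is the expression in these coordinates of the section `y ↦ (φ y, h y)`, where
`τ i y = h y (e i y)`. -/
def jetInFrame (φ : M → CP 1) (τ : Fin k → M → (Fin 1 → ℂ)) (x y : M) :
    M × CP 1 × (Fin k → Fin 1 → ℂ) :=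
  (y, φ y, fun i => (trivializationAt (Fin 1 → ℂ)
    (TangentSpace 𝓘(ℝ, Fin 1 → ℂ) : CP 1 → Type) (φ x)
    (⟨φ y, τ i y⟩ : TangentBundle 𝓘(ℝ, Fin 1 → ℂ) (CP 1))).2)

/-- The differential at `x` of the section `jetInFrame`. -/
def diffJet (φ : M → CP 1) (τ : Fin k → M → (Fin 1 → ℂ)) (x : M) :
    EuclideanSpace ℝ (Fin d) →L[ℝ]
      EuclideanSpace ℝ (Fin d) × (Fin 1 → ℂ) × (Fin k → Fin 1 → ℂ) :=
  mfderiv (𝓡 d) ((𝓡 d).prod (𝓘(ℝ, Fin 1 → ℂ).prod 𝓘(ℝ, Fin k → Fin 1 → ℂ)))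
    (jetInFrame φ τ x) x

/-- Transversality at `x`, along the subspace `K` of the tangent space of `M` at `x`, of the section
`jetInFrame` to the submanifold `Σ` of jets with vanishing linear part: the
preimage `K̂` of `K` by the projection to `M` is spanned by its intersections with the tangent
space of `Σ` and with the tangent space of the section. -/
def JetTransverseAlong (K : Submodule ℝ (EuclideanSpace ℝ (Fin d))) (φ : M → CP 1)
    (τ : Fin k → M → (Fin 1 → ℂ)) (x : M) : Prop :=
  let Khat : Submodule ℝ (EuclideanSpace ℝ (Fin d) × (Fin 1 → ℂ) × (Fin k → Fin 1 → ℂ)) :=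
    K.prod ⊤
  let TSigma : Submodule ℝ (EuclideanSpace ℝ (Fin d) × (Fin 1 → ℂ) × (Fin k → Fin 1 → ℂ)) :=
    (⊤ : Submodule ℝ (EuclideanSpace ℝ (Fin d))).prod
      ((⊤ : Submodule ℝ (Fin 1 → ℂ)).prod ⊥)
  let TSection := LinearMap.range (diffJet d φ τ x).toLinearMap
  (TSigma ⊓ Khat) ⊔ (TSection ⊓ Khat) = Khat

end Jets

section Hypersurface

variable {n : ℕ} {M : Type*} [TopologicalSpace M]
  [ChartedSpace (EuclideanSpace ℝ (Fin (2 * n + 1))) M]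

/-- `j` embeds `M` as a real hypersurface of class `C ^ 2` of `CP (n + 1)`. -/
structure IsHypersurfaceEmbedding (j : M → CP (n + 1)) : Prop where
  contMDiff : ContMDiff (𝓡 (2 * n + 1)) 𝓘(ℝ, Fin (n + 1) → ℂ) 2 j
  injective_diff : ∀ x, Function.Injective (diff (2 * n + 1) j x)
  isEmbedding : IsEmbedding j

/-- The hyperplane `a` is the projective hyperplane through `j x` whose tangent space at `j x` is
the complex tangent space of the hypersurface. -/
def IsTangentHyperplane (j : M → CP (n + 1)) (x : M) (a : CP (n + 1)) : Prop :=
  j x ∈ CP.linSubspace (CP.hyperplane a) ∧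
    CP.tangentLin (CP.hyperplane a) (j x) = complexTangent (2 * n + 1) j x

lemma existsUnique_isTangentHyperplane {j : M → CP (n + 1)} {x : M}
    (h : Function.Injective (diff (2 * n + 1) j x)) : ∃! a, IsTangentHyperplane j x a := by
  set T := realTangent (2 * n + 1) j x with hT
  set D := complexTangent (2 * n + 1) j x with hD
  have hlt : T < ⊤ := by
    refine lt_top_iff_ne_top.2 fun ht => ?_
    have h1 : Module.finrank ℝ T = 2 * n + 1 := by
      rw [hT, realTangent, LinearMap.finrank_range_of_inj h]
      simp
    have h2 : Module.finrank ℝ (Fin (n + 1) → ℂ) = 2 * (n + 1) := by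
      rw [Module.finrank_pi_fintype]
      simp [mul_comm]
    rw [ht, finrank_top, h2] at h1
    omega
  obtain ⟨g, hg0, hgT⟩ := Submodule.exists_le_ker_of_lt_top T hlt
  have hkg : LinearMap.ker g = T := by
    symm
    apply Submodule.eq_of_le_of_finrank_eq hgT
    have h1 : Module.finrank ℝ T = 2 * n + 1 := by
      rw [hT, realTangent, LinearMap.finrank_range_of_inj h]
      simp
    have h2 : Module.finrank ℝ (Fin (n + 1) → ℂ) = 2 * (n + 1) := by
      rw [Module.finrank_pi_fintype]
      simp [mul_comm]
    have h3 := Module.Dual.finrank_ker_add_one_of_ne_zero hg0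
    omega
  let P := (CP.dmk (j x)).toLinearMap
  let f : Module.Dual ℂ (Fin (n + 1) → ℂ) := Module.Dual.extendRCLike g
  have hf : ∀ w, f w = 0 ↔ w ∈ D := by
    intro w
    have e : f w = (g w : ℂ) - Complex.I * (g (Complex.I • w) : ℂ) := rfl
    have e' : w ∈ D ↔ g w = 0 ∧ g (Complex.I • w) = 0 := by
      change w ∈ T ∧ Complex.I • w ∈ T ↔ _
      rw [← hkg, LinearMap.mem_ker, LinearMap.mem_ker]
    rw [e, e', Complex.ext_iff]
    simp
  have hf0 : ∃ w, f w ≠ 0 := by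
    by_contra! hw
    refine hg0 (LinearMap.ext fun w => ?_)
    have : w ∈ T := ((hf w).1 (hw w)).1
    rwa [← hkg, LinearMap.mem_ker] at this
  let p : Module.Dual ℂ (Fin (n + 1 + 1) → ℂ) := f ∘ₗ P
  have hp : ∀ z, p z = ∑ i, p (Pi.single i 1) * z i := by
    intro z
    conv_lhs => rw [← Finset.univ_sum_single z]
    rw [map_sum]
    refine Finset.sum_congr rfl fun i _ => ?_
    have : (Pi.single i (z i) : Fin (n + 1 + 1) → ℂ) = z i • Pi.single i 1 := by
      rw [← Pi.single_smul, smul_eq_mul, mul_one]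
    rw [this, map_smul, smul_eq_mul, mul_comm]
  have ha : (fun i => p (Pi.single i 1)) ≠ 0 := by
    intro h0
    obtain ⟨w, hw⟩ := hf0
    obtain ⟨z, rfl⟩ := CP.dmk_surjective (j x) w
    refine hw ((hp z).trans (Finset.sum_eq_zero fun i _ => ?_))
    rw [congrFun h0 i]
    simp
  have hmem : ∀ z, z ∈ CP.hyperplane (CP.mk fun i => p (Pi.single i 1)) ↔
      CP.dmk (j x) z ∈ D := by
    intro z
    rw [CP.mem_hyperplane_mk ha, ← hp z]
    exact hf _
  refine ⟨CP.mk fun i => p (Pi.single i 1), ⟨?_, ?_⟩, ?_⟩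
  · refine (hmem _).2 ?_
    rw [CP.dmk_rep]
    exact zero_mem _
  · ext w
    constructor
    · rintro ⟨z, hz, rfl⟩
      exact (hmem z).1 hz
    · intro hw
      obtain ⟨z, rfl⟩ := CP.dmk_surjective (j x) w
      exact ⟨z, (hmem z).2 hw, rfl⟩
  · rintro b ⟨hb1, hb2⟩
    apply CP.eq_of_hyperplane_eq
    ext z
    rw [hmem, hD, ← hb2]
    constructor
    · exact fun hz => ⟨z, hz, rfl⟩
    · rintro ⟨y, hy, hyz⟩
      have hk : z - y ∈ LinearMap.ker (CP.dmk (j x)).toLinearMap := by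
        rw [LinearMap.mem_ker, map_sub, hyz]
        exact sub_self _
      rw [CP.ker_dmk] at hk
      have hk' : z - y ∈ CP.hyperplane b :=
        (Submodule.span_singleton_le_iff_mem _ _).2 hb1 hk
      simpa using add_mem hk' hy

/-- The complex dual map `ν`, which sends `x` to the tangent projective hyperplane `D_x M`. -/
def dualMap (j : M → CP (n + 1)) (x : M) : CP (n + 1) :=
  Classical.epsilon (IsTangentHyperplane j x)

lemma isTangentHyperplane_dualMap {j : M → CP (n + 1)} {x : M}
    (h : Function.Injective (diff (2 * n + 1) j x)) : IsTangentHyperplane j x (dualMap j x) :=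
  Classical.epsilon_spec (existsUnique_isTangentHyperplane h).exists

/-- The dual set is immersed: the dual map is an immersion. -/
def HasImmersedDualSet (j : M → CP (n + 1)) : Prop :=
  ∀ x, Function.Injective (diff (2 * n + 1) (dualMap j) x)

/-! ### Pencils of hyperplanes

The pencil `λ H₀ + μ H₁` is given by the coefficients `H 0`, `H 1` of two linear forms. -/

/-- The linear subspace of `ℂ ^ (n + 2)` defining the base locus `H₀ ∩ H₁`. -/
def baseSpace (H : Fin 2 → Fin (n + 1 + 1) → ℂ) : Submodule ℂ (Fin (n + 1 + 1) → ℂ) :=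
  LinearMap.ker (CP.linForm (H 0)) ⊓ LinearMap.ker (CP.linForm (H 1))

/-- The linear subspace of `ℂ ^ (n + 2)` defining the line `L` of the dual projective space formed
by the hyperplanes of the pencil. -/
def pencilSpace (H : Fin 2 → Fin (n + 1 + 1) → ℂ) : Submodule ℂ (Fin (n + 1 + 1) → ℂ) :=
  Submodule.span ℂ (Set.range H)

/-- The map `x ↦ [H₀ x : H₁ x]`, to be used away from the base locus. -/
def pencilMap (H : Fin 2 → Fin (n + 1 + 1) → ℂ) (x : CP (n + 1)) : CP 1 :=
  CP.mk (fun i => CP.linForm (H i) x.rep)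

/-- The differential of the pencil map. -/
def diffPencilMap (H : Fin 2 → Fin (n + 1 + 1) → ℂ) (x : CP (n + 1)) :
    (Fin (n + 1) → ℂ) →L[ℝ] (Fin 1 → ℂ) :=
  mfderiv 𝓘(ℝ, Fin (n + 1) → ℂ) 𝓘(ℝ, Fin 1 → ℂ) (pencilMap H) x

/-- The line `L` of hyperplanes of the pencil meets the dual set transversely: at each common point
it is transverse to all the branches of the dual set through that point. -/
def MeetsDualSetTransversely (j : M → CP (n + 1)) (H : Fin 2 → Fin (n + 1 + 1) → ℂ) : Prop :=
  ∀ a ∈ CP.linSubspace (pencilSpace H) ∩ Set.range (dualMap j), ∀ x, dualMap j x = a →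
    (CP.tangentLin (pencilSpace H) a).restrictScalars ℝ ⊔ realTangent (2 * n + 1) (dualMap j) x = ⊤

/-- The pencil map of `H` defines a CR Lefschetz pencil structure on the hypersurface.
The conditions on jets do not depend on the frames, which exist near every point. -/
structure IsCRLefschetzPencil (j : M → CP (n + 1)) (H : Fin 2 → Fin (n + 1 + 1) → ℂ) : Prop where
  /-- Any two members of the pencil intersect transversely, in the base locus. -/
  members : ∀ a ∈ CP.linSubspace (pencilSpace H), ∀ b ∈ CP.linSubspace (pencilSpace H), a ≠ b →
    CP.linSubspace (CP.hyperplane a) ∩ CP.linSubspace (CP.hyperplane b) =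
        CP.linSubspace (baseSpace H) ∧
      ∀ z ∈ CP.linSubspace (baseSpace H),
        CP.tangentLin (CP.hyperplane a) z ⊔ CP.tangentLin (CP.hyperplane b) z = ⊤
  /-- The base locus is transverse to the hypersurface. -/
  base : ∀ x, j x ∈ CP.linSubspace (baseSpace H) →
    (CP.tangentLin (baseSpace H) (j x)).restrictScalars ℝ ⊔ realTangent (2 * n + 1) j x = ⊤
  /-- The CR 1-jet of the restriction of the pencil map is transverse along `D` to the jets with
  vanishing linear part. -/
  jet_cr : ∀ x, j x ∉ CP.linSubspace (baseSpace H) →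
    (∀ u ∈ crDistribution (2 * n + 1) j x, diff (2 * n + 1) (pencilMap H ∘ j) x u = 0) →
    ∀ (k : ℕ) (X : Fin k → M → EuclideanSpace ℝ (Fin (2 * n + 1))),
      IsComplexFrameAt (2 * n + 1) j (complexTangent (2 * n + 1) j) (fun i y => diff (2 * n + 1) j y (X i y)) x →
      JetTransverseAlong (2 * n + 1) (crDistribution (2 * n + 1) j x) (pencilMap H ∘ j)
        (fun i y => diff (2 * n + 1) (pencilMap H ∘ j) y (X i y)) x
  /-- The 1-jet of the pencil map along the complex envelope of the tangent bundle is transverse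
  along the hypersurface to the jets with vanishing linear part. -/
  jet_envelope : ∀ x, j x ∉ CP.linSubspace (baseSpace H) →
    (∀ w ∈ complexEnvelope (2 * n + 1) j x, diffPencilMap H (j x) w = 0) →
    ∀ (k : ℕ) (e : Fin k → M → (Fin (n + 1) → ℂ)),
      IsComplexFrameAt (2 * n + 1) j (complexEnvelope (2 * n + 1) j) e x →
      JetTransverseAlong (2 * n + 1) ⊤ (pencilMap H ∘ j) (fun i y => diffPencilMap H (j y) (e i y)) x

end Hypersurface

end CRPencil

end

/-!
The proof rests on the duality between a hypersurface and its dual set. Let `ν = dualMap j`, let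
`F` and `A` be local lifts of `j` and `ν` to homogeneous coordinates, and let `D` be the CR
distribution. Since `A ⬝ᵥ F = 0` and `A ⬝ᵥ F' u = 0` for `u ∈ D`, also `A' u ⬝ᵥ F = 0`: the
differential of `ν` maps `D x` into the tangent space of the hyperplane of the dual space formed
by the hyperplanes through `j x`. Both have real dimension `2 n`, so equality holds when `ν` is an
immersion (`map_crDistribution_dualMap`).

Hence, at a point `x` whose tangent hyperplane belongs to the pencil, the line `L` is transverse
to the branch of the dual set if and only if `L` is not contained in the hyperplane dual to `j x`,
that is, `j x` is not in the base locus (`dual_transverse_iff`). On the other hand, at a point `x`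
over the base locus, the base locus is transverse to the hypersurface if and only if its tangent
space is not contained in that of the tangent hyperplane, that is, the tangent hyperplane at `x`
is not in the pencil (`base_transverse_iff`). So both the transversality of `L` to the dual set
and the transversality of the base locus to the hypersurface say that no tangent hyperplane at a
point over the base locus is in the pencil.

The remaining conditions of a CR Lefschetz pencil always hold. Distinct hyperplanes are
transverse. The complex envelope of the tangent space is the whole tangent space of projective
space, where the differential of the pencil map does not vanish, so the second jet never meets the
zero jets. The first one is transverse to the zero jets because `ν` is an immersion
(`jetTransverseAlong_crDistribution`): at a critical point, the derivative along `u ∈ D` of its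
linear part is computed by `A' u` up to a nonzero factor, and determines the differential of `ν`
at `u`.
-/

noncomputable section

/-! ### The differential of the projection to projective space -/

/-- The quotient rule for the real differential of complex-valued functions. -/
lemma hasFDerivAt_div_complex {V : Type*} [NormedAddCommGroup V] [NormedSpace ℝ V] {f g : V → ℂ}
    {f' g' : V →L[ℝ] ℂ} {x : V} (hf : HasFDerivAt f f' x) (hg : HasFDerivAt g g' x)
    (hx : g x ≠ 0) :
    HasFDerivAt (fun y => f y / g y) ((g x ^ 2)⁻¹ • (g x • f' - f x • g')) x := by
  have h1 : HasFDerivAt (fun z : ℂ => z⁻¹)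
      ((ContinuousLinearMap.toSpanSingleton ℂ (-(g x ^ 2)⁻¹)).restrictScalars ℝ) (g x) :=
    (hasDerivAt_inv hx).hasFDerivAt.restrictScalars ℝ
  simp only [div_eq_mul_inv]
  refine (hf.mul (h1.comp x hg)).congr_fderiv ?_
  ext u
  simp
  field_simp
  ring

namespace CP

variable {N : ℕ}

/-- The complex differential of the projection `v ↦ [v]` at an arbitrary vector `v`; the
differential `dmk x` is the case `v = x.rep`. -/
def diffMk (v : Fin (N + 1) → ℂ) : (Fin (N + 1) → ℂ) →L[ℂ] (Fin N → ℂ) :=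
  mfderiv 𝓘(ℂ, Fin (N + 1) → ℂ) 𝓘(ℂ, Fin N → ℂ) (mk : (Fin (N + 1) → ℂ) → CP N) v

lemma hasMFDerivAt_mk {v : Fin (N + 1) → ℂ} (hv : v ≠ 0) :
    HasMFDerivAt 𝓘(ℂ, Fin (N + 1) → ℂ) 𝓘(ℂ, Fin N → ℂ)
      (mk : (Fin (N + 1) → ℂ) → CP N) v (diffMk v) :=
  (mdifferentiableAt_mk hv).hasMFDerivAt

lemma hasMFDerivAt_mk_real {v : Fin (N + 1) → ℂ} (hv : v ≠ 0) :
    HasMFDerivAt 𝓘(ℝ, Fin (N + 1) → ℂ) 𝓘(ℝ, Fin N → ℂ)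
      (mk : (Fin (N + 1) → ℂ) → CP N) v ((diffMk v).restrictScalars ℝ) := by
  have h := hasMFDerivAt_mk hv
  exact ⟨h.1, HasFDerivWithinAt.restrictScalars (𝕜' := ℂ) ℝ h.2⟩

/-- The real differential at `p` of the affine chart `coord i`. -/
def diffCoord (i : Fin (N + 1)) (p : CP N) : (Fin N → ℂ) →L[ℝ] (Fin N → ℂ) :=
  mfderiv 𝓘(ℝ, Fin N → ℂ) 𝓘(ℝ, Fin N → ℂ) (coord i) p

lemma hasMFDerivAt_coord {i : Fin (N + 1)} {p : CP N} (hp : p.rep i ≠ 0) :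
    HasMFDerivAt 𝓘(ℝ, Fin N → ℂ) 𝓘(ℝ, Fin N → ℂ) (coord i) p (diffCoord i p) := by
  have h1 : MDifferentiableAt 𝓘(ℝ, Fin N → ℂ) 𝓘(ℝ, Fin N → ℂ) (affineChart i) p :=
    mdifferentiableAt_atlas (e := affineChart i) (Set.mem_range_self i) hp
  exact h1.hasMFDerivAt

lemma mk_smul {c : ℂ} (hc : c ≠ 0) {v : Fin (N + 1) → ℂ} (hv : v ≠ 0) : mk (c • v) = mk v := by
  rw [mk_of_ne hv, mk_of_ne (smul_ne_zero hc hv)]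
  exact (Projectivization.mk_eq_mk_iff' ℂ _ _ _ _).2 ⟨c, rfl⟩

lemma exists_eq_smul_rep {v : Fin (N + 1) → ℂ} (hv : v ≠ 0) :
    ∃ c : ℂ, c ≠ 0 ∧ v = c • (mk v).rep := by
  obtain ⟨a, ha, h⟩ := rep_mk' ⟨v, hv⟩
  refine ⟨a⁻¹, inv_ne_zero ha, ?_⟩
  rw [mk_of_ne hv, h, inv_smul_smul₀ ha]

lemma rep_mk_ne_zero_iff {v : Fin (N + 1) → ℂ} (hv : v ≠ 0) (i : Fin (N + 1)) :
    (mk v).rep i ≠ 0 ↔ v i ≠ 0 := by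
  obtain ⟨c, hc, h⟩ := exists_eq_smul_rep hv
  conv_rhs => rw [h]
  simp [hc]

lemma coord_mk {v : Fin (N + 1) → ℂ} (hv : v ≠ 0) (i : Fin (N + 1)) :
    coord i (mk v) = fun k => v (i.succAbove k) / v i := by
  rw [mk_of_ne hv, coord_mk']

/-- The projection is homogeneous of degree zero, so its differential has degree `-1`. -/
lemma diffMk_smul {c : ℂ} (hc : c ≠ 0) {v : Fin (N + 1) → ℂ} (hv : v ≠ 0)
    (E : Fin (N + 1) → ℂ) : diffMk (c • v) (c • E) = diffMk v E := by
  have h1 : HasMFDerivAt 𝓘(ℂ, Fin (N + 1) → ℂ) 𝓘(ℂ, Fin (N + 1) → ℂ)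
      (fun w : Fin (N + 1) → ℂ => c • w) v (c • ContinuousLinearMap.id ℂ (Fin (N + 1) → ℂ)) :=
    ((hasFDerivAt_id v).const_smul c).hasMFDerivAt
  have h2 := (hasMFDerivAt_mk (smul_ne_zero hc hv)).comp v h1
  have h3 : (mk ∘ fun w : Fin (N + 1) → ℂ => c • w) =ᶠ[𝓝 v] mk := by
    filter_upwards [isOpen_ne.mem_nhds hv] with w hw using mk_smul hc hw
  have h4 := (hasMFDerivAt_mk hv).congr_of_eventuallyEq h3
  exact DFunLike.congr_fun (hasMFDerivAt_unique h2 h4) E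

lemma diffMk_smul_left {c : ℂ} (hc : c ≠ 0) {v : Fin (N + 1) → ℂ} (hv : v ≠ 0)
    (E : Fin (N + 1) → ℂ) : diffMk (c • v) E = diffMk v (c⁻¹ • E) := by
  rw [← diffMk_smul hc hv, smul_inv_smul₀ hc]

lemma diffMk_eq_dmk {v : Fin (N + 1) → ℂ} (hv : v ≠ 0) :
    ∃ c : ℂ, c ≠ 0 ∧ v = c • (mk v).rep ∧ ∀ E, diffMk v E = dmk (mk v) (c⁻¹ • E) := by
  obtain ⟨c, hc, h⟩ := exists_eq_smul_rep hv
  refine ⟨c, hc, h, fun E => ?_⟩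
  conv_lhs => rw [h]
  exact diffMk_smul_left hc (mk v).rep_nonzero E

lemma diffMk_surjective {v : Fin (N + 1) → ℂ} (hv : v ≠ 0) :
    Function.Surjective (diffMk v) := by
  obtain ⟨c, hc, -, h⟩ := diffMk_eq_dmk hv
  intro w
  obtain ⟨E, rfl⟩ := dmk_surjective (mk v) w
  exact ⟨c • E, by rw [h, inv_smul_smul₀ hc]⟩

lemma diffMk_eq_zero_iff {v : Fin (N + 1) → ℂ} (hv : v ≠ 0) (E : Fin (N + 1) → ℂ) :
    diffMk v E = 0 ↔ E ∈ Submodule.span ℂ {v} := by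
  obtain ⟨c, hc, hvc, h⟩ := diffMk_eq_dmk hv
  have h1 : dmk (mk v) (c⁻¹ • E) = 0 ↔ c⁻¹ • E ∈ Submodule.span ℂ {(mk v).rep} := by
    rw [← ker_dmk]; rfl
  have h2 : Submodule.span ℂ {v} = Submodule.span ℂ {(mk v).rep} := by
    conv_lhs => rw [hvc]
    exact Submodule.span_singleton_smul_eq hc.isUnit _
  rw [h, h1, h2]
  exact Submodule.smul_mem_iff _ (inv_ne_zero hc)

lemma tangentLin_mk (S : Submodule ℂ (Fin (N + 1) → ℂ)) {v : Fin (N + 1) → ℂ} (hv : v ≠ 0) :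
    tangentLin S (mk v) = S.map (diffMk v).toLinearMap := by
  obtain ⟨c, hc, -, h⟩ := diffMk_eq_dmk hv
  ext w
  constructor
  · rintro ⟨E, hE, rfl⟩
    exact ⟨c • E, S.smul_mem _ hE, (h _).trans (by rw [inv_smul_smul₀ hc]; rfl)⟩
  · rintro ⟨E, hE, rfl⟩
    exact ⟨c⁻¹ • E, S.smul_mem _ hE, (h _).symm⟩

lemma mk_mem_linSubspace (S : Submodule ℂ (Fin (N + 1) → ℂ)) {v : Fin (N + 1) → ℂ}
    (hv : v ≠ 0) : mk v ∈ linSubspace S ↔ v ∈ S := by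
  obtain ⟨c, hc, h⟩ := exists_eq_smul_rep hv
  conv_rhs => rw [h]
  exact (Submodule.smul_mem_iff _ hc).symm

/-- For `mk v ∈ ℙ(S)`, the differential of the projection detects membership in `S`, since its
kernel, the line through `v`, is contained in `S`. -/
lemma diffMk_mem_tangentLin {S : Submodule ℂ (Fin (N + 1) → ℂ)} {v : Fin (N + 1) → ℂ}
    (hv : v ≠ 0) (hvS : v ∈ S) (E : Fin (N + 1) → ℂ) :
    diffMk v E ∈ tangentLin S (mk v) ↔ E ∈ S := by
  rw [tangentLin_mk S hv]
  refine ⟨?_, fun h => ⟨E, h, rfl⟩⟩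
  rintro ⟨E', hE', h⟩
  have h0 : diffMk v (E - E') = 0 := by
    rw [map_sub, sub_eq_zero]
    exact h.symm
  have h1 : E - E' ∈ S :=
    (Submodule.span_singleton_le_iff_mem _ _).2 hvS ((diffMk_eq_zero_iff hv _).1 h0)
  simpa using add_mem h1 hE'

/-- The differential of the projection in affine coordinates, by the quotient rule. -/
lemma diffCoord_diffMk {v : Fin (N + 1) → ℂ} (i : Fin (N + 1)) (hv : v i ≠ 0)
    (E : Fin (N + 1) → ℂ) :
    diffCoord i (mk v) (diffMk v E) = fun k =>
      (E (i.succAbove k) * v i - v (i.succAbove k) * E i) / v i ^ 2 := by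
  have hv0 : v ≠ 0 := fun h => hv (by rw [h]; rfl)
  have h1 := (hasMFDerivAt_coord ((rep_mk_ne_zero_iff hv0 i).2 hv)).comp v
    (hasMFDerivAt_mk_real hv0)
  have h2 : (coord i ∘ mk) =ᶠ[𝓝 v] fun v k => v (i.succAbove k) / v i := by
    filter_upwards [isOpen_ne.mem_nhds hv0] with w hw using coord_mk hw i
  have h3 := (h1.congr_of_eventuallyEq h2.symm).hasFDerivAt
  have h4 := fun k => hasFDerivAt_pi'.1 h3 k
  funext k
  have hp : ∀ l, HasFDerivAt (𝕜 := ℝ) (fun v : Fin (N + 1) → ℂ => v l)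
    (ContinuousLinearMap.proj l) v := fun l => hasFDerivAt_apply l v
  have h5 := (h4 k).unique (hasFDerivAt_div_complex (hp (i.succAbove k)) (hp i) hv)
  have h6 := DFunLike.congr_fun h5 E
  refine h6.trans ?_
  simp only [FunLike.coe_smul, FunLike.coe_sub, Pi.smul_apply, Pi.sub_apply,
    ContinuousLinearMap.proj_apply, smul_eq_mul]
  ring

/-- The affine lift of a tangent vector is a preimage of it by the differential of the
projection. -/
lemma diffMk_insertNth (i : Fin (N + 1)) {p : CP N} (hp : p.rep i ≠ 0) (e : Fin N → ℂ) :
    diffMk (i.insertNth (1 : ℂ) (coord i p)) (i.insertNth (0 : ℂ) (diffCoord i p e)) = e := by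
  set v : Fin (N + 1) → ℂ := i.insertNth (1 : ℂ) (coord i p) with hv
  have hv0 : v ≠ 0 := insertNth_ne_zero _ _
  have hvi : v i = 1 := by simp [hv]
  have hmk : mk v = p := by
    rw [mk_of_ne hv0]
    exact (affineChart i).left_inv hp
  obtain ⟨E, rfl⟩ := diffMk_surjective hv0 e
  have h := diffCoord_diffMk i (v := v) (by simp [hvi]) E
  rw [hmk] at h
  rw [h, ← sub_eq_zero, ← map_sub, diffMk_eq_zero_iff hv0, Submodule.mem_span_singleton]
  refine ⟨- E i, ?_⟩
  funext k
  refine Fin.succAboveCases i ?_ (fun k => ?_) k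
  · simp [hvi]
  · simp [hvi]
    ring

end CP

/-! ### Lifts to homogeneous coordinates -/

namespace CP

variable {N : ℕ}

lemma exists_chartAt_eq (p : CP N) :
    ∃ i, chartAt (Fin N → ℂ) p = affineChart i ∧ p.rep i ≠ 0 :=
  ⟨(exists_rep_ne_zero p).choose, rfl, (exists_rep_ne_zero p).choose_spec⟩

/-- The preferred trivialization of the tangent bundle of `CP N` is given by the differential of
the affine chart. -/
lemma trivializationAt_apply_snd {p₀ : CP N} {i : Fin (N + 1)}
    (hi : chartAt (Fin N → ℂ) p₀ = affineChart i) {p : CP N} (hp : p.rep i ≠ 0) (w : Fin N → ℂ) :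
    (trivializationAt (Fin N → ℂ) (TangentSpace 𝓘(ℝ, Fin N → ℂ) : CP N → Type) p₀
      (⟨p, w⟩ : TangentBundle 𝓘(ℝ, Fin N → ℂ) (CP N))).2 = diffCoord i p w := by
  have hs : p ∈ (chartAt (Fin N → ℂ) p₀).source := by rw [hi]; exact hp
  have h := TangentBundle.continuousLinearMapAt_trivializationAt
    (I := 𝓘(ℝ, Fin N → ℂ)) hs
  have h1 := DFunLike.congr_fun h w
  have h2 : p ∈ (trivializationAt (Fin N → ℂ) (TangentSpace 𝓘(ℝ, Fin N → ℂ) : CP N → Type)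
      p₀).baseSet := hs
  have h4 := congrFun (Bundle.Trivialization.coe_linearMapAt_of_mem (R := ℝ)
    (trivializationAt (Fin N → ℂ) (TangentSpace 𝓘(ℝ, Fin N → ℂ) : CP N → Type) p₀) h2) w
  refine h4.symm.trans (h1.trans ?_)
  have h3 : (extChartAt 𝓘(ℝ, Fin N → ℂ) p₀ : CP N → (Fin N → ℂ)) = coord i := by
    rw [extChartAt_coe, hi]; rfl
  rw [h3]
  rfl

end CP

namespace CRPencil

variable {d N : ℕ} {M : Type*}

/-- The lift to homogeneous coordinates, normalized to have `i`-th coordinate `1`, of a map to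
projective space. -/
def affineLift (i : Fin (N + 1)) (f : M → CP N) (y : M) : Fin (N + 1) → ℂ :=
  i.insertNth (1 : ℂ) (CP.coord i (f y))

/-- The lift of a vector field along `f`, with `i`-th coordinate `0`. -/
def affineLiftField (i : Fin (N + 1)) (f : M → CP N) (e : M → (Fin N → ℂ)) (y : M) :
    Fin (N + 1) → ℂ :=
  i.insertNth (0 : ℂ) (CP.diffCoord i (f y) (e y))

lemma affineLift_ne_zero (i : Fin (N + 1)) (f : M → CP N) (y : M) : affineLift i f y ≠ 0 :=
  CP.insertNth_ne_zero _ _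

lemma mk_affineLift {i : Fin (N + 1)} {f : M → CP N} {y : M} (hy : (f y).rep i ≠ 0) :
    CP.mk (affineLift i f y) = f y := by
  rw [CP.mk_of_ne (affineLift_ne_zero i f y)]
  exact (CP.affineChart i).left_inv hy

lemma diffMk_affineLift {i : Fin (N + 1)} {f : M → CP N} {y : M} (hy : (f y).rep i ≠ 0)
    (e : M → (Fin N → ℂ)) : CP.diffMk (affineLift i f y) (affineLiftField i f e y) = e y :=
  CP.diffMk_insertNth i hy (e y)

variable [TopologicalSpace M]

lemma eventually_rep_ne_zero {i : Fin (N + 1)} {f : M → CP N} {x : M} (hf : ContinuousAt f x)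
    (hx : (f x).rep i ≠ 0) : ∀ᶠ y in 𝓝 x, (f y).rep i ≠ 0 :=
  hf.eventually ((CP.isOpen_source i).mem_nhds hx)

variable [ChartedSpace (EuclideanSpace ℝ (Fin d)) M]

lemma differentiable_insertNth (i : Fin (N + 1)) (c : ℂ) :
    Differentiable ℝ (fun w : Fin N → ℂ => (i.insertNth c w : Fin (N + 1) → ℂ)) := by
  refine differentiable_pi.2 fun l => ?_
  refine Fin.succAboveCases i ?_ (fun k => ?_) l
  · simp
  · simp only [Fin.insertNth_apply_succAbove]
    fun_prop

lemma mdifferentiableAt_affineLift {i : Fin (N + 1)} {f : M → CP N} {x : M}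
    (hf : MDifferentiableAt (𝓡 d) 𝓘(ℝ, Fin N → ℂ) f x) (hx : (f x).rep i ≠ 0) :
    MDifferentiableAt (𝓡 d) 𝓘(ℝ, Fin (N + 1) → ℂ) (affineLift i f) x := by
  have h1 := (CP.hasMFDerivAt_coord hx).mdifferentiableAt.comp x hf
  exact (differentiable_insertNth i 1).differentiableAt.mdifferentiableAt.comp x h1

lemma mdifferentiableAt_affineLiftField {i : Fin (N + 1)} {f : M → CP N} {x : M}
    (hi : chartAt (Fin N → ℂ) (f x) = CP.affineChart i) (hx : (f x).rep i ≠ 0)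
    {e : M → (Fin N → ℂ)}
    (he : ContMDiffAt (𝓡 d) (𝓘(ℝ, Fin N → ℂ).prod 𝓘(ℝ, Fin N → ℂ)) 1
      (fun y => (⟨f y, e y⟩ : TangentBundle 𝓘(ℝ, Fin N → ℂ) (CP N))) x) :
    MDifferentiableAt (𝓡 d) 𝓘(ℝ, Fin (N + 1) → ℂ) (affineLiftField i f e) x := by
  have h := Bundle.contMDiffAt_totalSpace.1 he
  have h1 : ContMDiffAt (𝓡 d) 𝓘(ℝ, Fin N → ℂ) 1 f x := h.1
  have h2 := h.2.mdifferentiableAt one_ne_zero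
  have h3 : MDifferentiableAt (𝓡 d) 𝓘(ℝ, Fin N → ℂ)
      (fun y => CP.diffCoord i (f y) (e y)) x := by
    refine h2.congr_of_eventuallyEq ?_
    filter_upwards [eventually_rep_ne_zero h1.continuousAt hx] with y hy
    exact (CP.trivializationAt_apply_snd hi hy (e y)).symm
  exact (differentiable_insertNth i 0).differentiableAt.mdifferentiableAt.comp x h3

/-- The differential of a map to projective space is computed on a lift to homogeneous
coordinates. -/
lemma hasMFDerivAt_of_lift {f : M → CP N} {F : M → (Fin (N + 1) → ℂ)} {x : M}
    {F' : EuclideanSpace ℝ (Fin d) →L[ℝ] (Fin (N + 1) → ℂ)}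
    (hF : HasMFDerivAt (𝓡 d) 𝓘(ℝ, Fin (N + 1) → ℂ) F x F') (h0 : F x ≠ 0)
    (hf : ∀ᶠ y in 𝓝 x, CP.mk (F y) = f y) :
    HasMFDerivAt (𝓡 d) 𝓘(ℝ, Fin N → ℂ) f x
      (((CP.diffMk (F x)).restrictScalars ℝ).comp F' :
        EuclideanSpace ℝ (Fin d) →L[ℝ] (Fin N → ℂ)) :=
  ((CP.hasMFDerivAt_mk_real h0).comp x hF).congr_of_eventuallyEq
    (hf.mono fun _ h => h.symm)

lemma diff_of_lift {f : M → CP N} {F : M → (Fin (N + 1) → ℂ)} {x : M}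
    {F' : EuclideanSpace ℝ (Fin d) →L[ℝ] (Fin (N + 1) → ℂ)}
    (hF : HasMFDerivAt (𝓡 d) 𝓘(ℝ, Fin (N + 1) → ℂ) F x F') (h0 : F x ≠ 0)
    (hf : ∀ᶠ y in 𝓝 x, CP.mk (F y) = f y) (u : EuclideanSpace ℝ (Fin d)) :
    diff d f x u = CP.diffMk (F x) (F' u) :=
  DFunLike.congr_fun (hasMFDerivAt_of_lift hF h0 hf).mfderiv u

/-- A differentiable map to projective space has a differentiable lift near each point. -/
lemma exists_lift {f : M → CP N} {x : M} (hf : MDifferentiableAt (𝓡 d) 𝓘(ℝ, Fin N → ℂ) f x) :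
    ∃ (F : M → (Fin (N + 1) → ℂ)) (F' : EuclideanSpace ℝ (Fin d) →L[ℝ] (Fin (N + 1) → ℂ)),
      HasMFDerivAt (𝓡 d) 𝓘(ℝ, Fin (N + 1) → ℂ) F x F' ∧ (∀ y, F y ≠ 0) ∧
      (∀ᶠ y in 𝓝 x, CP.mk (F y) = f y) ∧ ∀ u, diff d f x u = CP.diffMk (F x) (F' u) := by
  obtain ⟨i, hi⟩ := CP.exists_rep_ne_zero (f x)
  have h := (mdifferentiableAt_affineLift hf hi).hasMFDerivAt
  have h2 : ∀ᶠ y in 𝓝 x, CP.mk (affineLift i f y) = f y := by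
    filter_upwards [eventually_rep_ne_zero hf.continuousAt hi] with y hy using mk_affineLift hy
  exact ⟨_, _, h, affineLift_ne_zero i f, h2,
    diff_of_lift h (affineLift_ne_zero i f x) h2⟩

/-- A differentiable frame along `f` has a differentiable lift near each point. -/
lemma exists_lift_frame {f : M → CP N} {x : M}
    (hf : MDifferentiableAt (𝓡 d) 𝓘(ℝ, Fin N → ℂ) f x) {k : ℕ} {e : Fin k → M → (Fin N → ℂ)}
    (he : ∀ l, ContMDiffAt (𝓡 d) (𝓘(ℝ, Fin N → ℂ).prod 𝓘(ℝ, Fin N → ℂ)) 1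
      (fun y => (⟨f y, e l y⟩ : TangentBundle 𝓘(ℝ, Fin N → ℂ) (CP N))) x) :
    ∃ (F : M → (Fin (N + 1) → ℂ)) (F' : EuclideanSpace ℝ (Fin d) →L[ℝ] (Fin (N + 1) → ℂ))
      (E : Fin k → M → (Fin (N + 1) → ℂ))
      (E' : Fin k → EuclideanSpace ℝ (Fin d) →L[ℝ] (Fin (N + 1) → ℂ)),
      HasMFDerivAt (𝓡 d) 𝓘(ℝ, Fin (N + 1) → ℂ) F x F' ∧ (∀ y, F y ≠ 0) ∧
      (∀ᶠ y in 𝓝 x, CP.mk (F y) = f y) ∧ (∀ u, diff d f x u = CP.diffMk (F x) (F' u)) ∧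
      (∀ l, HasMFDerivAt (𝓡 d) 𝓘(ℝ, Fin (N + 1) → ℂ) (E l) x (E' l)) ∧
      ∀ᶠ y in 𝓝 x, ∀ l, CP.diffMk (F y) (E l y) = e l y := by
  obtain ⟨i, hi, hx⟩ := CP.exists_chartAt_eq (f x)
  have h := (mdifferentiableAt_affineLift hf hx).hasMFDerivAt
  have hev := eventually_rep_ne_zero hf.continuousAt hx
  have h2 : ∀ᶠ y in 𝓝 x, CP.mk (affineLift i f y) = f y := hev.mono fun y hy => mk_affineLift hy
  exact ⟨_, _, fun l => affineLiftField i f (e l), _, h, affineLift_ne_zero i f, h2,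
    diff_of_lift h (affineLift_ne_zero i f x) h2,
    fun l => (mdifferentiableAt_affineLiftField hi hx (he l)).hasMFDerivAt,
    hev.mono fun y hy l => diffMk_affineLift hy (e l)⟩

/-- An injective differential on a nonzero tangent space is not the junk value `0`. -/
lemma mdifferentiableAt_of_injective {m : ℕ} {M : Type*} [TopologicalSpace M]
    [ChartedSpace (EuclideanSpace ℝ (Fin (m + 1))) M] {f : M → CP N} {x : M}
    (h : Function.Injective (diff (m + 1) f x)) :
    MDifferentiableAt (𝓡 (m + 1)) 𝓘(ℝ, Fin N → ℂ) f x := by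
  by_contra hn
  have h0 : diff (m + 1) f x = 0 := mfderiv_zero_of_not_mdifferentiableAt hn
  rw [h0] at h
  obtain ⟨u, hu⟩ := exists_ne (0 : EuclideanSpace ℝ (Fin (m + 1)))
  exact hu (h rfl)

/-- The differential, in the preferred chart, of a map with values in a vector space. -/
lemma _root_.HasMFDerivAt.hasFDerivAt_comp_symm {W : Type*} [NormedAddCommGroup W]
    [NormedSpace ℝ W] {F : M → W} {x : M} {F' : EuclideanSpace ℝ (Fin d) →L[ℝ] W}
    (h : HasMFDerivAt (𝓡 d) 𝓘(ℝ, W) F x F') :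
    HasFDerivAt (F ∘ (extChartAt (𝓡 d) x).symm) F' (extChartAt (𝓡 d) x x) := by
  have h1 : HasFDerivWithinAt (F ∘ (extChartAt (𝓡 d) x).symm) F' (Set.range (𝓡 d))
    (extChartAt (𝓡 d) x x) := h.2
  rwa [ModelWithCorners.range_eq_univ, hasFDerivWithinAt_univ] at h1

end CRPencil

/-! ### Duality along the CR distribution -/

lemma finrank_restrictScalars_complex {W : Type*} [AddCommGroup W] [Module ℂ W]
    (S : Submodule ℂ W) : Module.finrank ℝ (S.restrictScalars ℝ) = 2 * Module.finrank ℂ S :=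
  finrank_real_of_complex S

namespace CP

variable {N : ℕ}

lemma mem_hyperplane_iff (a : CP N) (z : Fin (N + 1) → ℂ) :
    z ∈ hyperplane a ↔ a.rep ⬝ᵥ z = 0 := by
  rw [hyperplane, LinearMap.mem_ker, linForm_apply]; rfl

lemma mem_hyperplane_mk_iff {a : Fin (N + 1) → ℂ} (ha : a ≠ 0) (z : Fin (N + 1) → ℂ) :
    z ∈ hyperplane (mk a) ↔ a ⬝ᵥ z = 0 := mem_hyperplane_mk ha z

lemma mem_linSubspace_hyperplane_comm (a p : CP N) :
    p ∈ linSubspace (hyperplane a) ↔ a ∈ linSubspace (hyperplane p) := by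
  change p.rep ∈ hyperplane a ↔ a.rep ∈ hyperplane p
  rw [mem_hyperplane_iff, mem_hyperplane_iff, dotProduct_comm]

lemma linForm_ne_zero {a : Fin (N + 1) → ℂ} (ha : a ≠ 0) : linForm a ≠ 0 := by
  intro h
  refine ha (funext fun i => ?_)
  simpa [linForm_apply, Pi.single_apply] using DFunLike.congr_fun h (Pi.single i 1)

lemma finrank_hyperplane (a : CP N) : Module.finrank ℂ (hyperplane a) = N := by
  have h := Module.Dual.finrank_ker_add_one_of_ne_zero (linForm_ne_zero a.rep_nonzero)
  rw [Module.finrank_fintype_fun_eq_card, Fintype.card_fin] at h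
  exact Nat.succ_injective h

lemma dmk_mem_tangentLin {S : Submodule ℂ (Fin (N + 1) → ℂ)} {p : CP N} (hp : p ∈ linSubspace S)
    (E : Fin (N + 1) → ℂ) : dmk p E ∈ tangentLin S p ↔ E ∈ S := by
  have h := diffMk_mem_tangentLin p.rep_nonzero hp E
  rwa [mk_rep] at h

lemma tangentLin_le_iff {S S' : Submodule ℂ (Fin (N + 1) → ℂ)} {p : CP N}
    (hp : p ∈ linSubspace S') : tangentLin S p ≤ tangentLin S' p ↔ S ≤ S' :=
  ⟨fun h E hE => (dmk_mem_tangentLin hp E).1 (h ⟨E, hE, rfl⟩), fun h => Submodule.map_mono h⟩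

lemma finrank_tangentLin_hyperplane {a p : CP (N + 1)} (hp : p ∈ linSubspace (hyperplane a)) :
    Module.finrank ℂ (tangentLin (hyperplane a) p) = N := by
  have h := LinearMap.finrank_range_add_finrank_ker
    ((dmk p).toLinearMap.domRestrict (hyperplane a))
  rw [LinearMap.range_domRestrict, LinearMap.ker_domRestrict, ker_dmk, finrank_hyperplane] at h
  have h1 : Module.finrank ℂ ((Submodule.span ℂ {p.rep}).comap (hyperplane a).subtype) = 1 := by
    rw [(Submodule.comapSubtypeEquivOfLe
      ((Submodule.span_singleton_le_iff_mem _ _).2 hp)).finrank_eq,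
      finrank_span_singleton p.rep_nonzero]
  have h2 : Module.finrank ℂ ((Submodule.span ℂ {p.rep}).submoduleOf (hyperplane a)) = 1 := h1
  change Module.finrank ℂ (tangentLin (hyperplane a) p) + _ = _ at h
  omega

end CP

namespace CRPencil

/-- Product rule for the vanishing dot product of two maps. -/
lemma dotProduct_deriv_eq_zero {d m : ℕ} {M : Type*} [TopologicalSpace M]
    [ChartedSpace (EuclideanSpace ℝ (Fin d)) M] {A B : M → (Fin m → ℂ)} {x : M}
    {A' B' : EuclideanSpace ℝ (Fin d) →L[ℝ] (Fin m → ℂ)}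
    (hA : HasMFDerivAt (𝓡 d) 𝓘(ℝ, Fin m → ℂ) A x A')
    (hB : HasMFDerivAt (𝓡 d) 𝓘(ℝ, Fin m → ℂ) B x B')
    (h : ∀ᶠ y in 𝓝 x, A y ⬝ᵥ B y = 0) (u : EuclideanSpace ℝ (Fin d)) :
    A' u ⬝ᵥ B x + A x ⬝ᵥ B' u = 0 := by
  have hA1 := hasFDerivAt_pi'.1 hA.hasFDerivAt_comp_symm
  have hB1 := hasFDerivAt_pi'.1 hB.hasFDerivAt_comp_symm
  have h1 := HasFDerivAt.fun_sum (u := Finset.univ) fun i _ => (hA1 i).mul (hB1 i)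
  have hx : (extChartAt (𝓡 d) x).symm (extChartAt (𝓡 d) x x) = x := extChartAt_to_inv x
  have hc := continuousAt_extChartAt_symm (I := 𝓡 d) x
  rw [ContinuousAt, hx] at hc
  have h2 := h1.unique ((hasFDerivAt_const (0 : ℂ) _).congr_of_eventuallyEq (hc.eventually h))
  have h3 := DFunLike.congr_fun h2 u
  simp [Finset.sum_add_distrib] at h3
  rw [← h3, add_comm]
  simp [dotProduct, mul_comm]

section

variable {n : ℕ} {M : Type*} [TopologicalSpace M]
  [ChartedSpace (EuclideanSpace ℝ (Fin (2 * n + 1))) M] {j : M → CP (n + 1)} {x : M}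

lemma finrank_realTangent {f : M → CP (n + 1)}
    (h : Function.Injective (diff (2 * n + 1) f x)) :
    Module.finrank ℝ (realTangent (2 * n + 1) f x) = 2 * n + 1 := by
  rw [realTangent, LinearMap.finrank_range_of_inj h]
  simp

lemma finrank_real_target : Module.finrank ℝ (Fin (n + 1) → ℂ) = 2 * n + 2 := by
  rw [Module.finrank_pi_fintype]
  simp
  ring

lemma realTangent_ne_top {f : M → CP (n + 1)}
    (h : Function.Injective (diff (2 * n + 1) f x)) : realTangent (2 * n + 1) f x ≠ ⊤ := by
  intro ht
  have h1 := finrank_realTangent h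
  rw [ht, finrank_top, finrank_real_target] at h1
  omega

/-- The real tangent space has real codimension one, hence is maximal. -/
lemma sup_realTangent_eq_top {f : M → CP (n + 1)}
    (h : Function.Injective (diff (2 * n + 1) f x)) {S : Submodule ℝ (Fin (n + 1) → ℂ)}
    (hS : ¬ S ≤ realTangent (2 * n + 1) f x) : S ⊔ realTangent (2 * n + 1) f x = ⊤ := by
  apply Submodule.eq_top_of_finrank_eq
  have h1 : realTangent (2 * n + 1) f x < S ⊔ realTangent (2 * n + 1) f x :=
    right_lt_sup.2 hS
  have h2 := Submodule.finrank_lt_finrank_of_lt h1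
  have h3 := Submodule.finrank_le (S ⊔ realTangent (2 * n + 1) f x)
  rw [finrank_realTangent h] at h2
  rw [finrank_real_target] at h3 ⊢
  omega

lemma complexTangent_le_realTangent :
    (complexTangent (2 * n + 1) j x).restrictScalars ℝ ≤ realTangent (2 * n + 1) j x :=
  fun _ h => h.1

/-- A complex subspace of the real tangent space lies in the complex tangent space. -/
lemma le_complexTangent {S : Submodule ℂ (Fin (n + 1) → ℂ)}
    (h : S.restrictScalars ℝ ≤ realTangent (2 * n + 1) j x) :
    S ≤ complexTangent (2 * n + 1) j x :=
  fun _ hw => ⟨h hw, h (S.smul_mem Complex.I hw)⟩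

lemma map_crDistribution : (crDistribution (2 * n + 1) j x).map (diff (2 * n + 1) j x).toLinearMap =
    (complexTangent (2 * n + 1) j x).restrictScalars ℝ := by
  rw [crDistribution, Submodule.map_comap_eq]
  exact inf_eq_right.2 complexTangent_le_realTangent

lemma finrank_complexTangent (hj : Function.Injective (diff (2 * n + 1) j x)) :
    Module.finrank ℂ (complexTangent (2 * n + 1) j x) = n := by
  have h := isTangentHyperplane_dualMap hj
  rw [← h.2]
  exact CP.finrank_tangentLin_hyperplane h.1

lemma finrank_crDistribution (hj : Function.Injective (diff (2 * n + 1) j x)) :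
    Module.finrank ℝ (crDistribution (2 * n + 1) j x) = 2 * n := by
  rw [(Submodule.equivMapOfInjective (diff (2 * n + 1) j x).toLinearMap hj _).finrank_eq,
    map_crDistribution, finrank_restrictScalars_complex, finrank_complexTangent hj]

lemma dotProduct_lift_eq_zero (hj : Function.Injective (diff (2 * n + 1) j x))
    {A F : Fin (n + 1 + 1) → ℂ} (hA0 : A ≠ 0) (hF0 : F ≠ 0) (hA : CP.mk A = dualMap j x)
    (hF : CP.mk F = j x) : A ⬝ᵥ F = 0 := by
  have h := (isTangentHyperplane_dualMap hj).1
  rwa [← hF, CP.mk_mem_linSubspace _ hF0, ← hA, CP.mem_hyperplane_mk_iff hA0] at h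

/-- The complex tangent space in homogeneous coordinates: it is cut out by the coordinates of the
tangent hyperplane. -/
lemma diffMk_mem_complexTangent_iff (hj : Function.Injective (diff (2 * n + 1) j x))
    {A F : Fin (n + 1 + 1) → ℂ} (hA0 : A ≠ 0) (hF0 : F ≠ 0) (hA : CP.mk A = dualMap j x)
    (hF : CP.mk F = j x) (E : Fin (n + 1 + 1) → ℂ) :
    CP.diffMk F E ∈ complexTangent (2 * n + 1) j x ↔ A ⬝ᵥ E = 0 := by
  have h := isTangentHyperplane_dualMap hj
  have hm := h.1
  rw [← hF, CP.mk_mem_linSubspace _ hF0] at hm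
  rw [← h.2, ← hF, CP.diffMk_mem_tangentLin hF0 hm, ← hA, CP.mem_hyperplane_mk_iff hA0]

/-- Duality: differentiating the incidence of a point and its tangent hyperplane, the image of the
CR distribution by the dual map is tangent to the hyperplane dual to the point. -/
lemma dotProduct_deriv_lift_eq_zero (hj : ∀ y, Function.Injective (diff (2 * n + 1) j y))
    {A F : M → (Fin (n + 1 + 1) → ℂ)}
    {A' F' : EuclideanSpace ℝ (Fin (2 * n + 1)) →L[ℝ] (Fin (n + 1 + 1) → ℂ)}
    (hF : HasMFDerivAt (𝓡 (2 * n + 1)) 𝓘(ℝ, Fin (n + 1 + 1) → ℂ) F x F') (hF0 : ∀ y, F y ≠ 0)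
    (hFj : ∀ᶠ y in 𝓝 x, CP.mk (F y) = j y)
    (hA : HasMFDerivAt (𝓡 (2 * n + 1)) 𝓘(ℝ, Fin (n + 1 + 1) → ℂ) A x A') (hA0 : ∀ y, A y ≠ 0)
    (hAν : ∀ᶠ y in 𝓝 x, CP.mk (A y) = dualMap j y)
    {u : EuclideanSpace ℝ (Fin (2 * n + 1))} (hu : u ∈ crDistribution (2 * n + 1) j x) :
    A' u ⬝ᵥ F x = 0 := by
  have hAF : ∀ᶠ y in 𝓝 x, A y ⬝ᵥ F y = 0 := by
    filter_upwards [hFj, hAν] with y h1 h2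
    exact dotProduct_lift_eq_zero (hj y) (hA0 y) (hF0 y) h2 h1
  have h1 : diff (2 * n + 1) j x u ∈ complexTangent (2 * n + 1) j x := hu
  rw [diff_of_lift hF (hF0 x) hFj, diffMk_mem_complexTangent_iff (hj x) (hA0 x) (hF0 x)
    hAν.self_of_nhds hFj.self_of_nhds] at h1
  have h := dotProduct_deriv_eq_zero hA hF hAF u
  rwa [h1, add_zero] at h

lemma diff_dualMap_mem (hj : ∀ y, Function.Injective (diff (2 * n + 1) j y))
    (hν : MDifferentiableAt (𝓡 (2 * n + 1)) 𝓘(ℝ, Fin (n + 1) → ℂ) (dualMap j) x)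
    {u : EuclideanSpace ℝ (Fin (2 * n + 1))} (hu : u ∈ crDistribution (2 * n + 1) j x) :
    diff (2 * n + 1) (dualMap j) x u ∈ CP.tangentLin (CP.hyperplane (j x)) (dualMap j x) := by
  obtain ⟨F, F', hF, hF0, hFj, -⟩ := exists_lift (mdifferentiableAt_of_injective (hj x))
  obtain ⟨A, A', hA, hA0, hAν, hAu⟩ := exists_lift hν
  have hx1 := hFj.self_of_nhds
  have hx2 := hAν.self_of_nhds
  have h := dotProduct_deriv_lift_eq_zero hj hF hF0 hFj hA hA0 hAν hu
  rw [hAu, ← hx1, ← hx2, CP.diffMk_mem_tangentLin (hA0 x), CP.mem_hyperplane_mk_iff (hF0 x),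
    dotProduct_comm, h]
  rw [CP.mem_hyperplane_mk_iff (hF0 x), dotProduct_comm]
  exact dotProduct_lift_eq_zero (hj x) (hA0 x) (hF0 x) hx2 hx1

/-- If the dual map is immersed, it sends the CR distribution onto the tangent space of the
hyperplane dual to the point: both have real dimension `2 n`. -/
lemma map_crDistribution_dualMap (hj : ∀ y, Function.Injective (diff (2 * n + 1) j y))
    (hν : Function.Injective (diff (2 * n + 1) (dualMap j) x)) :
    (crDistribution (2 * n + 1) j x).map (diff (2 * n + 1) (dualMap j) x).toLinearMap =
      (CP.tangentLin (CP.hyperplane (j x)) (dualMap j x)).restrictScalars ℝ := by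
  apply Submodule.eq_of_le_of_finrank_eq
  · rintro _ ⟨u, hu, rfl⟩
    exact diff_dualMap_mem hj (mdifferentiableAt_of_injective hν) hu
  · rw [← (Submodule.equivMapOfInjective (diff (2 * n + 1) (dualMap j) x).toLinearMap
      hν _).finrank_eq, finrank_crDistribution (hj x), finrank_restrictScalars_complex,
      CP.finrank_tangentLin_hyperplane]
    exact (CP.mem_linSubspace_hyperplane_comm _ _).1 (isTangentHyperplane_dualMap (hj x)).1

end

end CRPencil

/-! ### Pencils of hyperplanes and the two transversality conditions -/

namespace CRPencil

section

variable {n : ℕ} {H : Fin 2 → Fin (n + 1 + 1) → ℂ}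

lemma mem_baseSpace_iff (z : Fin (n + 1 + 1) → ℂ) : z ∈ baseSpace H ↔ ∀ i, H i ⬝ᵥ z = 0 := by
  rw [Fin.forall_fin_two, baseSpace, Submodule.mem_inf, LinearMap.mem_ker, LinearMap.mem_ker,
    CP.linForm_apply, CP.linForm_apply]
  rfl

lemma mem_baseSpace_iff_forall_mem_pencilSpace (z : Fin (n + 1 + 1) → ℂ) :
    z ∈ baseSpace H ↔ ∀ a ∈ pencilSpace H, a ⬝ᵥ z = 0 := by
  rw [mem_baseSpace_iff]
  refine ⟨fun h a ha => ?_, fun h i => h _ (Submodule.subset_span ⟨i, rfl⟩)⟩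
  induction ha using Submodule.span_induction with
  | mem a ha => obtain ⟨i, rfl⟩ := ha; exact h i
  | zero => exact zero_dotProduct _
  | add a b _ _ ha hb => rw [add_dotProduct, ha, hb, add_zero]
  | smul c a _ ha => rw [smul_dotProduct, ha, smul_zero]

/-- A hyperplane contains the base locus if and only if it is a member of the pencil. -/
lemma baseSpace_le_hyperplane_iff (a : CP (n + 1)) :
    baseSpace H ≤ CP.hyperplane a ↔ a ∈ CP.linSubspace (pencilSpace H) := by
  constructor
  · intro h
    have h1 : CP.linForm a.rep ∈ Submodule.span ℂ (Set.range fun i => CP.linForm (H i)) := by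
      refine mem_span_of_iInf_ker_le_ker fun z hz => h ?_
      rw [Submodule.mem_iInf] at hz
      exact ⟨hz 0, hz 1⟩
    obtain ⟨c, hc⟩ := (Submodule.mem_span_range_iff_exists_fun ℂ).1 h1
    refine (Submodule.mem_span_range_iff_exists_fun ℂ).2 ⟨c, ?_⟩
    funext l
    have h2 := DFunLike.congr_fun hc (Pi.single l 1)
    simpa [CP.linForm_apply, Pi.single_apply] using h2
  · intro h z hz
    rw [CP.mem_hyperplane_iff]
    exact (mem_baseSpace_iff_forall_mem_pencilSpace z).1 hz _ h

/-- Two distinct members of the pencil intersect exactly in the base locus. -/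
lemma hyperplane_inf_hyperplane (hH : LinearIndependent ℂ H) {a b : CP (n + 1)}
    (ha : a ∈ CP.linSubspace (pencilSpace H)) (hb : b ∈ CP.linSubspace (pencilSpace H))
    (hab : a ≠ b) : CP.hyperplane a ⊓ CP.hyperplane b = baseSpace H := by
  refine le_antisymm (fun z hz => ?_)
    (le_inf ((baseSpace_le_hyperplane_iff a).2 ha) ((baseSpace_le_hyperplane_iff b).2 hb))
  have hli : LinearIndependent ℂ ![a.rep, b.rep] := by
    refine (LinearIndependent.pair_iff' a.rep_nonzero).2 fun c hc => hab ?_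
    rw [← Projectivization.mk_rep a, ← Projectivization.mk_rep b]
    exact ((Projectivization.mk_eq_mk_iff' ℂ _ _ _ _).2 ⟨c, hc⟩).symm
  have hspan : Submodule.span ℂ (Set.range ![a.rep, b.rep]) = pencilSpace H := by
    apply Submodule.eq_of_le_of_finrank_eq
    · rw [Submodule.span_le]
      rintro _ ⟨i, rfl⟩
      fin_cases i
      exacts [ha, hb]
    · rw [pencilSpace, finrank_span_eq_card hli, finrank_span_eq_card hH]
  rw [mem_baseSpace_iff_forall_mem_pencilSpace, ← hspan]
  intro c hc
  induction hc using Submodule.span_induction with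
  | mem c hc =>
    obtain ⟨i, rfl⟩ := hc
    fin_cases i
    exacts [(CP.mem_hyperplane_iff _ _).1 hz.1, (CP.mem_hyperplane_iff _ _).1 hz.2]
  | zero => exact zero_dotProduct _
  | add a b _ _ ha hb => rw [add_dotProduct, ha, hb, add_zero]
  | smul c a _ ha => rw [smul_dotProduct, ha, smul_zero]

/-- Two distinct hyperplanes are transverse. -/
lemma tangentLin_hyperplane_sup {a b : CP (n + 1)} (hab : a ≠ b) (z : CP (n + 1)) :
    CP.tangentLin (CP.hyperplane a) z ⊔ CP.tangentLin (CP.hyperplane b) z = ⊤ := by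
  have h : CP.hyperplane a ⊔ CP.hyperplane b = ⊤ := by
    have hlt : CP.hyperplane a < CP.hyperplane a ⊔ CP.hyperplane b := by
      refine left_lt_sup.2 fun hle => hab (CP.eq_of_hyperplane_eq ?_)
      exact (Submodule.eq_of_le_of_finrank_eq hle (by simp only [CP.finrank_hyperplane])).symm
    have h1 := Submodule.finrank_lt_finrank_of_lt hlt
    have h2 := Submodule.finrank_le (CP.hyperplane a ⊔ CP.hyperplane b)
    apply Submodule.eq_top_of_finrank_eq
    rw [CP.finrank_hyperplane] at h1
    rw [Module.finrank_fintype_fun_eq_card, Fintype.card_fin] at h2 ⊢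
    omega
  rw [CP.tangentLin, CP.tangentLin, ← Submodule.map_sup, h, Submodule.map_top]
  exact LinearMap.range_eq_top.2 (CP.dmk_surjective z)

variable {M : Type*} [TopologicalSpace M]
  [ChartedSpace (EuclideanSpace ℝ (Fin (2 * n + 1))) M] {j : M → CP (n + 1)} {x : M}

/-- At a common point, the base locus is transverse to the hypersurface exactly when the tangent
hyperplane is not a member of the pencil: a complex subspace of the real tangent space lies in its
maximal complex subspace, which is the tangent space of that hyperplane. -/
lemma base_transverse_iff (hj : Function.Injective (diff (2 * n + 1) j x)) :
    (CP.tangentLin (baseSpace H) (j x)).restrictScalars ℝ ⊔ realTangent (2 * n + 1) j x = ⊤ ↔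
      dualMap j x ∉ CP.linSubspace (pencilSpace H) := by
  obtain ⟨h1, h2⟩ := isTangentHyperplane_dualMap hj
  rw [← baseSpace_le_hyperplane_iff, ← CP.tangentLin_le_iff h1, h2]
  constructor
  · intro h hle
    have hle' : (CP.tangentLin (baseSpace H) (j x)).restrictScalars ℝ ≤
        realTangent (2 * n + 1) j x := fun w hw => complexTangent_le_realTangent (hle hw)
    rw [sup_eq_right.2 hle'] at h
    exact realTangent_ne_top hj h
  · exact fun h => sup_realTangent_eq_top hj fun hle => h (le_complexTangent hle)

/-- If the dual map is immersed, the line of the pencil is transverse to the branch of the dual set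
at a member tangent to the hypersurface at `j x` exactly when `j x` is not in the base locus. -/
lemma dual_transverse_iff (hj : ∀ y, Function.Injective (diff (2 * n + 1) j y))
    (hν : Function.Injective (diff (2 * n + 1) (dualMap j) x)) :
    (CP.tangentLin (pencilSpace H) (dualMap j x)).restrictScalars ℝ ⊔
        realTangent (2 * n + 1) (dualMap j) x = ⊤ ↔
      j x ∉ CP.linSubspace (baseSpace H) := by
  have hle : (CP.tangentLin (CP.hyperplane (j x)) (dualMap j x)).restrictScalars ℝ ≤
      realTangent (2 * n + 1) (dualMap j) x := by
    rw [← map_crDistribution_dualMap hj hν]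
    exact LinearMap.map_le_range
  constructor
  · intro h hB
    have hle' : CP.tangentLin (pencilSpace H) (dualMap j x) ≤
        CP.tangentLin (CP.hyperplane (j x)) (dualMap j x) := by
      refine Submodule.map_mono fun a ha => ?_
      rw [CP.mem_hyperplane_iff, dotProduct_comm]
      exact (mem_baseSpace_iff_forall_mem_pencilSpace _).1 hB a ha
    rw [sup_eq_right.2 (le_trans (fun w hw => hle' hw) hle)] at h
    exact realTangent_ne_top hν h
  · intro hB
    have hB' : ¬ ∀ a ∈ pencilSpace H, a ⬝ᵥ (j x).rep = 0 := fun h =>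
      hB ((mem_baseSpace_iff_forall_mem_pencilSpace _).2 h)
    push Not at hB'
    obtain ⟨a, ha, haz⟩ := hB'
    refine eq_top_iff.2 fun w _ => ?_
    obtain ⟨b, rfl⟩ := CP.dmk_surjective (dualMap j x) w
    -- Split `b` along the member `a` of the pencil, which does not pass through `j x`.
    set t : ℂ := (b ⬝ᵥ (j x).rep) / (a ⬝ᵥ (j x).rep) with ht
    have hb : b - t • a ∈ CP.hyperplane (j x) := by
      rw [CP.mem_hyperplane_iff, dotProduct_comm, sub_dotProduct, smul_dotProduct, ht, smul_eq_mul,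
        div_mul_cancel₀ _ haz, sub_self]
    have e : CP.dmk (dualMap j x) b = CP.dmk (dualMap j x) (t • a) +
        CP.dmk (dualMap j x) (b - t • a) := by
      rw [← map_add, add_sub_cancel]
    rw [e]
    exact Submodule.add_mem_sup ⟨t • a, Submodule.smul_mem _ _ ha, rfl⟩ (hle ⟨_, hb, rfl⟩)

end

end CRPencil

/-! ### The differential of the pencil map -/

lemma mem_span_singleton_of_dotProduct {m : ℕ} {a b : Fin m → ℂ}
    (h : ∀ z, a ⬝ᵥ z = 0 → b ⬝ᵥ z = 0) : b ∈ Submodule.span ℂ {a} := by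
  have h1 : dotProductEquiv ℂ (Fin m) b ∈
      Submodule.span ℂ (Set.range fun _ : Unit => dotProductEquiv ℂ (Fin m) a) := by
    refine mem_span_of_iInf_ker_le_ker fun z hz => h z ?_
    simpa using hz
  rw [Set.range_const, Submodule.mem_span_singleton] at h1
  obtain ⟨c, hc⟩ := h1
  refine Submodule.mem_span_singleton.2 ⟨c, (dotProductEquiv ℂ (Fin m)).injective ?_⟩
  rw [map_smul, hc]

namespace CRPencil

section

variable {n : ℕ} {H : Fin 2 → Fin (n + 1 + 1) → ℂ}

/-- The pair of linear forms defining the pencil. -/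
def pencilForm (H : Fin 2 → Fin (n + 1 + 1) → ℂ) :
    (Fin (n + 1 + 1) → ℂ) →L[ℂ] (Fin 2 → ℂ) :=
  ContinuousLinearMap.pi fun i => (CP.linForm (H i)).toContinuousLinearMap

lemma pencilForm_apply (v : Fin (n + 1 + 1) → ℂ) (i : Fin 2) : pencilForm H v i = H i ⬝ᵥ v :=
  CP.linForm_apply (H i) v

lemma pencilForm_ne_zero_iff (v : Fin (n + 1 + 1) → ℂ) :
    pencilForm H v ≠ 0 ↔ v ∉ baseSpace H := by
  rw [mem_baseSpace_iff, Ne, funext_iff]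
  simp [pencilForm_apply]

lemma pencilMap_mk {v : Fin (n + 1 + 1) → ℂ} (hv : v ∉ baseSpace H) :
    pencilMap H (CP.mk v) = CP.mk (pencilForm H v) := by
  have hv0 : v ≠ 0 := fun h => hv (h ▸ zero_mem _)
  obtain ⟨c, hc, h⟩ := CP.exists_eq_smul_rep hv0
  have h1 : pencilForm H v = c • pencilForm H (CP.mk v).rep := by rw [← map_smul, ← h]
  have h2 : pencilForm H (CP.mk v).rep ≠ 0 := fun h0 =>
    (pencilForm_ne_zero_iff v).2 hv (by rw [h1, h0, smul_zero])
  rw [h1, CP.mk_smul hc h2]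
  rfl

lemma isOpen_notMem_baseSpace : IsOpen {v : Fin (n + 1 + 1) → ℂ | v ∉ baseSpace H} := by
  simp_rw [← pencilForm_ne_zero_iff]
  exact isOpen_ne_fun (pencilForm H).continuous continuous_const

lemma mdifferentiableAt_pencilMap {p : CP (n + 1)} (hp : p ∉ CP.linSubspace (baseSpace H)) :
    MDifferentiableAt 𝓘(ℝ, Fin (n + 1) → ℂ) 𝓘(ℝ, Fin 1 → ℂ) (pencilMap H) p := by
  obtain ⟨i, hi⟩ := CP.exists_rep_ne_zero p
  have hmk : ∀ q : CP (n + 1), q.rep i ≠ 0 → CP.mk (affineLift i id q) = q :=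
    fun q hq => mk_affineLift (f := id) hq
  have hs : MDifferentiableAt 𝓘(ℝ, Fin (n + 1) → ℂ) 𝓘(ℝ, Fin (n + 1 + 1) → ℂ)
      (affineLift i (id : CP (n + 1) → CP (n + 1))) p :=
    (differentiable_insertNth i 1).differentiableAt.mdifferentiableAt.comp p
      (CP.hasMFDerivAt_coord hi).mdifferentiableAt
  have hb : affineLift i id p ∉ baseSpace H := fun h => hp (by
    have h1 := (CP.mk_mem_linSubspace (baseSpace H) (affineLift_ne_zero i id p)).2 h
    rwa [hmk p hi] at h1)
  have h1 : MDifferentiableAt 𝓘(ℝ, Fin (n + 1 + 1) → ℂ) 𝓘(ℝ, Fin 2 → ℂ) (pencilForm H)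
      (affineLift i id p) :=
    ((pencilForm H).restrictScalars ℝ).differentiableAt.mdifferentiableAt
  have h2 := (CP.hasMFDerivAt_mk_real ((pencilForm_ne_zero_iff _).2 hb)).mdifferentiableAt
  have h3 := h2.comp p (h1.comp p hs)
  refine h3.congr_of_eventuallyEq ?_
  filter_upwards [(CP.isOpen_source i).mem_nhds hi,
    hs.continuousAt.eventually (isOpen_notMem_baseSpace.mem_nhds hb)] with q hq hqb
  conv_lhs => rw [← hmk q hq]
  exact pencilMap_mk hqb

/-- In homogeneous coordinates, the differential of the pencil map is given by the two linear
forms. -/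
lemma diffPencilMap_diffMk {v : Fin (n + 1 + 1) → ℂ} (hv : v ∉ baseSpace H)
    (E : Fin (n + 1 + 1) → ℂ) :
    diffPencilMap H (CP.mk v) (CP.diffMk v E) = CP.diffMk (pencilForm H v) (pencilForm H E) := by
  have hv0 : v ≠ 0 := fun h => hv (h ▸ zero_mem _)
  have hp : CP.mk v ∉ CP.linSubspace (baseSpace H) := by rwa [CP.mk_mem_linSubspace _ hv0]
  have h1 := (mdifferentiableAt_pencilMap hp).hasMFDerivAt.comp v (CP.hasMFDerivAt_mk_real hv0)
  have h2 : HasMFDerivAt 𝓘(ℝ, Fin (n + 1 + 1) → ℂ) 𝓘(ℝ, Fin 2 → ℂ) (pencilForm H) v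
      ((pencilForm H).restrictScalars ℝ) :=
    ((pencilForm H).restrictScalars ℝ).hasFDerivAt.hasMFDerivAt
  have h3 := (CP.hasMFDerivAt_mk_real ((pencilForm_ne_zero_iff _).2 hv)).comp v h2
  have h4 : (pencilMap H ∘ CP.mk) =ᶠ[𝓝 v] (CP.mk ∘ pencilForm H) := by
    filter_upwards [isOpen_notMem_baseSpace.mem_nhds hv] with w hw using pencilMap_mk hw
  exact DFunLike.congr_fun (hasMFDerivAt_unique h1 (h3.congr_of_eventuallyEq h4)) E

lemma pencilForm_surjective (hH : LinearIndependent ℂ H) : Function.Surjective (pencilForm H) := by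
  have h : Function.Surjective (Matrix.of H).mulVecLin := by
    rw [← LinearMap.range_eq_top]
    apply Submodule.eq_top_of_finrank_eq
    have := LinearIndependent.rank_matrix (M := Matrix.of H) hH
    rw [Matrix.rank] at this
    simpa using this
  have e : ∀ v, pencilForm H v = (Matrix.of H).mulVecLin v := fun v =>
    funext fun i => pencilForm_apply v i
  exact fun b => (h b).imp fun v hv => (e v).trans hv

/-- Away from its base locus the pencil map is a submersion. -/
lemma exists_diffPencilMap_ne_zero (hH : LinearIndependent ℂ H) {p : CP (n + 1)}
    (hp : p ∉ CP.linSubspace (baseSpace H)) : ∃ w, diffPencilMap H p w ≠ 0 := by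
  obtain ⟨w, hw⟩ := exists_ne (0 : Fin 1 → ℂ)
  obtain ⟨c, rfl⟩ := CP.diffMk_surjective ((pencilForm_ne_zero_iff p.rep).2 hp) w
  obtain ⟨E, rfl⟩ := pencilForm_surjective hH c
  refine ⟨CP.diffMk p.rep E, ?_⟩
  rw [← diffPencilMap_diffMk hp, CP.mk_rep] at hw
  exact hw

variable {M : Type*} [TopologicalSpace M]
  [ChartedSpace (EuclideanSpace ℝ (Fin (2 * n + 1))) M] {j : M → CP (n + 1)} {x : M}

/-- A complex subspace has even real dimension, so the complex envelope of the tangent space of a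
real hypersurface is the whole tangent space of projective space. -/
lemma complexEnvelope_eq_top (hj : Function.Injective (diff (2 * n + 1) j x)) :
    complexEnvelope (2 * n + 1) j x = ⊤ := by
  have hle : realTangent (2 * n + 1) j x ≤
      (complexEnvelope (2 * n + 1) j x).restrictScalars ℝ := fun w hw => Submodule.subset_span hw
  have h1 := Submodule.finrank_mono hle
  rw [finrank_realTangent hj, finrank_restrictScalars_complex] at h1
  have h2 := Submodule.finrank_le (complexEnvelope (2 * n + 1) j x)
  apply Submodule.eq_top_of_finrank_eq
  rw [Module.finrank_fintype_fun_eq_card, Fintype.card_fin] at h2 ⊢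
  omega

end

end CRPencil

/-! ### Transversality of jets -/

namespace CRPencil

section

variable {d k : ℕ} {M : Type*} [TopologicalSpace M] [ChartedSpace (EuclideanSpace ℝ (Fin d)) M]

/-- The quotient `(α β - γ δ) / β ^ 2` is the derivative of `γ / β` along a vector field with
components `α`, `δ`. This computes its derivative at a zero, along vectors tangent to the level set
of `γ / β`. -/
lemma exists_hasMFDerivAt_quotient {α β γ δ : M → ℂ}
    {α' β' γ' δ' : EuclideanSpace ℝ (Fin d) →L[ℝ] ℂ}
    {x : M} (hα : HasMFDerivAt (𝓡 d) 𝓘(ℝ, ℂ) α x α') (hβ : HasMFDerivAt (𝓡 d) 𝓘(ℝ, ℂ) β x β')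
    (hγ : HasMFDerivAt (𝓡 d) 𝓘(ℝ, ℂ) γ x γ') (hδ : HasMFDerivAt (𝓡 d) 𝓘(ℝ, ℂ) δ x δ')
    {c : ℂ} (h0 : β x ≠ 0) (h1 : α x = c * δ x) (h2 : γ x = c * β x) :
    ∃ g' : EuclideanSpace ℝ (Fin d) →L[ℝ] ℂ,
      HasMFDerivAt (𝓡 d) 𝓘(ℝ, ℂ) (fun y => (α y * β y - γ y * δ y) / β y ^ 2) x g' ∧
      ∀ u, γ' u = c * β' u → g' u = (α' u - c * δ' u) / β x := by
  have hx : (extChartAt (𝓡 d) x).symm (extChartAt (𝓡 d) x x) = x := extChartAt_to_inv x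
  have hα1 := hα.hasFDerivAt_comp_symm
  have hβ1 := hβ.hasFDerivAt_comp_symm
  have hγ1 := hγ.hasFDerivAt_comp_symm
  have hδ1 := hδ.hasFDerivAt_comp_symm
  have hd := hasFDerivAt_div_complex ((hα1.mul hβ1).sub (hγ1.mul hδ1)) (hβ1.mul hβ1)
    (by simpa [hx] using h0)
  have hc : ContinuousAt (fun y => (α y * β y - γ y * δ y) / (β y * β y)) x :=
    ((hα.continuousAt.mul hβ.continuousAt).sub (hγ.continuousAt.mul hδ.continuousAt)).div
      (hβ.continuousAt.mul hβ.continuousAt) (mul_ne_zero h0 h0)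
  have e : (fun y => (α y * β y - γ y * δ y) / β y ^ 2) =
      fun y => (α y * β y - γ y * δ y) / (β y * β y) := funext fun y => by rw [sq]
  rw [e]
  refine ⟨_, ⟨hc, hd.hasFDerivWithinAt⟩, fun u hu => ?_⟩
  simp only [FunLike.coe_smul, FunLike.coe_sub, FunLike.coe_add, Pi.smul_apply, Pi.sub_apply,
    Pi.add_apply, Function.comp_apply, Pi.mul_apply, hx, smul_eq_mul, h1, h2, hu]
  field_simp
  ring

/-- A section of the bundle of jets is transverse along `K` to the jets with vanishing linear part
as soon as the derivative of its linear part maps `K` onto the fibre. -/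
lemma jetTransverseAlong_of_surjective {K : Submodule ℝ (EuclideanSpace ℝ (Fin d))}
    {φ : M → CP 1} {τ : Fin k → M → (Fin 1 → ℂ)} {x : M}
    (hφ : MDifferentiableAt (𝓡 d) 𝓘(ℝ, Fin 1 → ℂ) φ x)
    {G' : EuclideanSpace ℝ (Fin d) →L[ℝ] (Fin k → Fin 1 → ℂ)}
    (hG : HasMFDerivAt (𝓡 d) 𝓘(ℝ, Fin k → Fin 1 → ℂ) (fun y => (jetInFrame φ τ x y).2.2) x G')
    (hK : ∀ w, ∃ u ∈ K, G' u = w) : JetTransverseAlong d K φ τ x := by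
  have h := (hasMFDerivAt_id (I := 𝓡 d) x).prodMk (hφ.hasMFDerivAt.prodMk hG)
  have hd : ∀ u, (diffJet d φ τ x u).1 = u ∧ (diffJet d φ τ x u).2.2 = G' u := fun u => by
    have := DFunLike.congr_fun h.mfderiv u
    have h1 : diffJet d φ τ x u = (u, diff d φ x u, G' u) := this
    rw [h1]
    exact ⟨rfl, rfl⟩
  refine le_antisymm (sup_le inf_le_right inf_le_right) ?_
  rintro ⟨u, z, w⟩ ⟨hu, -⟩
  obtain ⟨u₀, hu₀, rfl⟩ := hK w
  have e : (u, z, G' u₀) = ((u - u₀, z - (diffJet d φ τ x u₀).2.1, 0) :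
      EuclideanSpace ℝ (Fin d) × (Fin 1 → ℂ) × (Fin k → Fin 1 → ℂ)) + diffJet d φ τ x u₀ := by
    ext1
    · simp [(hd u₀).1]
    · ext1
      · simp
      · simp [(hd u₀).2]
  rw [e]
  refine Submodule.add_mem_sup ⟨⟨trivial, trivial, rfl⟩, ⟨sub_mem hu hu₀, trivial⟩⟩
    ⟨⟨u₀, rfl⟩, ⟨?_, trivial⟩⟩
  change (diffJet d φ τ x u₀).1 ∈ K
  rwa [(hd u₀).1]

lemma hasMFDerivAt_dotProduct {m : ℕ} {F : M → (Fin m → ℂ)} {x : M}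
    {F' : EuclideanSpace ℝ (Fin d) →L[ℝ] (Fin m → ℂ)}
    (hF : HasMFDerivAt (𝓡 d) 𝓘(ℝ, Fin m → ℂ) F x F') (a : Fin m → ℂ) :
    ∃ g' : EuclideanSpace ℝ (Fin d) →L[ℝ] ℂ,
      HasMFDerivAt (𝓡 d) 𝓘(ℝ, ℂ) (fun y => a ⬝ᵥ F y) x g' ∧ ∀ u, g' u = a ⬝ᵥ F' u := by
  let L : (Fin m → ℂ) →L[ℝ] ℂ :=
    LinearMap.toContinuousLinearMap ((dotProductEquiv ℂ (Fin m) a).restrictScalars ℝ)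
  exact ⟨L.comp F', (L.hasFDerivAt.hasMFDerivAt).comp x hF, fun _ => rfl⟩

end

end CRPencil

/-! ### The jet along the CR distribution -/

namespace CRPencil

section

variable {n : ℕ} {H : Fin 2 → Fin (n + 1 + 1) → ℂ} {M : Type*} [TopologicalSpace M]
  [ChartedSpace (EuclideanSpace ℝ (Fin (2 * n + 1))) M] {j : M → CP (n + 1)} {x : M}

/-- At a critical point of the pencil map along the CR distribution, the linear form of the pencil
vanishing there is that of the tangent hyperplane. -/
lemma exists_pencil_member_eq_smul (hH : LinearIndependent ℂ H)
    (hj : Function.Injective (diff (2 * n + 1) j x)) {A F : Fin (n + 1 + 1) → ℂ} (hA0 : A ≠ 0)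
    (hF0 : F ≠ 0) (hA : CP.mk A = dualMap j x) (hF : CP.mk F = j x) (hFb : F ∉ baseSpace H)
    (hcrit : ∀ w ∈ complexTangent (2 * n + 1) j x, diffPencilMap H (j x) w = 0)
    {i i' : Fin 2} (hii' : i' ≠ i) {c : ℂ} (hc : H i' ⬝ᵥ F = c * (H i ⬝ᵥ F)) :
    ∃ s : ℂ, s ≠ 0 ∧ H i' - c • H i = s • A := by
  have h1 : H i' - c • H i ∈ Submodule.span ℂ {A} := by
    refine mem_span_singleton_of_dotProduct fun E hE => ?_
    have h2 := hcrit _ ((diffMk_mem_complexTangent_iff hj hA0 hF0 hA hF E).2 hE)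
    rw [← hF, diffPencilMap_diffMk hFb,
      CP.diffMk_eq_zero_iff ((pencilForm_ne_zero_iff F).2 hFb), Submodule.mem_span_singleton] at h2
    obtain ⟨t, ht⟩ := h2
    have h3 := fun l => congrFun ht l
    simp only [Pi.smul_apply, pencilForm_apply, smul_eq_mul] at h3
    rw [sub_dotProduct, smul_dotProduct, smul_eq_mul, ← h3, ← h3, hc]
    ring
  obtain ⟨s, hs⟩ := Submodule.mem_span_singleton.1 h1
  refine ⟨s, fun h0 => ?_, hs.symm⟩
  rw [h0, zero_smul] at hs
  have h4 : LinearIndependent ℂ ![H i, H i'] := by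
    have := hH.comp ![i, i'] (by
      intro a b
      fin_cases a <;> fin_cases b <;> simp [hii', hii'.symm])
    convert this using 1
    funext a
    fin_cases a <;> rfl
  exact (LinearIndependent.pair_iff' (hH.ne_zero i)).1 h4 c (sub_eq_zero.1 hs.symm).symm

/-- The jet of the pencil map along the CR distribution is transverse to the jets with vanishing
linear part at every critical point, because the dual map is immersed there. In homogeneous
coordinates, let `A` be a lift of the dual map and `E l` a frame of `D`. At a critical point the
derivative along `u ∈ D` of the linear part of the jet is a nonzero multiple of
`l ↦ A ⬝ᵥ E' l u = - A' u ⬝ᵥ E l`. If it vanishes, then `A' u` is a multiple of `A`, so `u` is in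
the kernel of the differential of the dual map. -/
lemma jetTransverseAlong_crDistribution (hH : LinearIndependent ℂ H)
    (hj : ∀ y, Function.Injective (diff (2 * n + 1) j y))
    (hν : Function.Injective (diff (2 * n + 1) (dualMap j) x))
    (hx : j x ∉ CP.linSubspace (baseSpace H))
    (hcrit : ∀ u ∈ crDistribution (2 * n + 1) j x, diff (2 * n + 1) (pencilMap H ∘ j) x u = 0)
    {k : ℕ} {X : Fin k → M → EuclideanSpace ℝ (Fin (2 * n + 1))}
    (hX : IsComplexFrameAt (2 * n + 1) j (complexTangent (2 * n + 1) j)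
      (fun i y => diff (2 * n + 1) j y (X i y)) x) :
    JetTransverseAlong (2 * n + 1) (crDistribution (2 * n + 1) j x) (pencilMap H ∘ j)
      (fun i y => diff (2 * n + 1) (pencilMap H ∘ j) y (X i y)) x := by
  have hjd : ∀ y, MDifferentiableAt (𝓡 (2 * n + 1)) 𝓘(ℝ, Fin (n + 1) → ℂ) j y :=
    fun y => mdifferentiableAt_of_injective (hj y)
  have hchain : ∀ y, j y ∉ CP.linSubspace (baseSpace H) → ∀ u,
      diff (2 * n + 1) (pencilMap H ∘ j) y u =
        diffPencilMap H (j y) (diff (2 * n + 1) j y u) := fun y hy u =>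
    DFunLike.congr_fun (mfderiv_comp y (mdifferentiableAt_pencilMap hy) (hjd y)) u
  have hφ : MDifferentiableAt (𝓡 (2 * n + 1)) 𝓘(ℝ, Fin 1 → ℂ) (pencilMap H ∘ j) x :=
    (mdifferentiableAt_pencilMap hx).comp x (hjd x)
  obtain ⟨F, F', E, E', hF, hF0, hFj, hFu, hE, hEe⟩ :=
    exists_lift_frame (hjd x) hX.contMDiffAt
  obtain ⟨A, A', hA, hA0, hAν, hAu⟩ := exists_lift (mdifferentiableAt_of_injective hν)
  have hxF := hFj.self_of_nhds
  have hxA := hAν.self_of_nhds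
  have hFb : F x ∉ baseSpace H := by
    rwa [← CP.mk_mem_linSubspace _ (hF0 x), hxF]
  have hFb' : ∀ᶠ y in 𝓝 x, F y ∉ baseSpace H :=
    hF.continuousAt.eventually (isOpen_notMem_baseSpace.mem_nhds hFb)
  -- The linear part of the jet in homogeneous coordinates.
  obtain ⟨i, hi, hxi⟩ := CP.exists_chartAt_eq (pencilMap H (j x))
  set i' : Fin 2 := i.succAbove 0 with hi'
  have hpx : pencilMap H (j x) = CP.mk (pencilForm H (F x)) := by rw [← hxF, pencilMap_mk hFb]
  have hβ0 : H i ⬝ᵥ F x ≠ 0 := by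
    rwa [hpx, CP.rep_mk_ne_zero_iff ((pencilForm_ne_zero_iff _).2 hFb), pencilForm_apply] at hxi
  have hβev : ∀ᶠ y in 𝓝 x, H i ⬝ᵥ F y ≠ 0 := by
    obtain ⟨g', hg, -⟩ := hasMFDerivAt_dotProduct hF (H i)
    exact hg.continuousAt.eventually_ne hβ0
  have hjet : ∀ᶠ y in 𝓝 x, (jetInFrame (pencilMap H ∘ j)
      (fun l y => diff (2 * n + 1) (pencilMap H ∘ j) y (X l y)) x y).2.2 = fun l _ =>
        ((H i' ⬝ᵥ E l y) * (H i ⬝ᵥ F y) - (H i' ⬝ᵥ F y) * (H i ⬝ᵥ E l y)) / (H i ⬝ᵥ F y) ^ 2 := by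
    filter_upwards [hFj, hEe, hFb', hβev] with y h1 h2 h3 h4
    have h5 : j y ∉ CP.linSubspace (baseSpace H) := by
      rwa [← h1, CP.mk_mem_linSubspace _ (hF0 y)]
    have h6 : pencilForm H (F y) i ≠ 0 := by rwa [pencilForm_apply]
    have h7 : pencilMap H (j y) = CP.mk (pencilForm H (F y)) := by rw [← h1, pencilMap_mk h3]
    have h8 : (pencilMap H (j y)).rep i ≠ 0 := by
      rwa [h7, CP.rep_mk_ne_zero_iff ((pencilForm_ne_zero_iff _).2 h3)]
    funext l m
    change (trivializationAt (Fin 1 → ℂ) (TangentSpace 𝓘(ℝ, Fin 1 → ℂ) : CP 1 → Type)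
      (pencilMap H (j x)) (⟨pencilMap H (j y), diff (2 * n + 1) (pencilMap H ∘ j) y (X l y)⟩ :
        TangentBundle 𝓘(ℝ, Fin 1 → ℂ) (CP 1))).2 m = _
    rw [CP.trivializationAt_apply_snd hi h8, hchain y h5, ← h2 l, h7]
    conv_lhs => rw [← h1]
    rw [diffPencilMap_diffMk h3, CP.diffCoord_diffMk i h6, Subsingleton.elim m 0]
    simp only [pencilForm_apply, ← hi']
  -- The member `H i' - c H i` of the pencil vanishing at `j x` is the tangent hyperplane.
  set c : ℂ := (H i' ⬝ᵥ F x) / (H i ⬝ᵥ F x) with hcdef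
  have hc : H i' ⬝ᵥ F x = c * (H i ⬝ᵥ F x) := (div_mul_cancel₀ _ hβ0).symm
  have hcrit' : ∀ w ∈ complexTangent (2 * n + 1) j x, diffPencilMap H (j x) w = 0 := by
    intro w hw
    obtain ⟨u, rfl⟩ := hw.1
    exact (hchain x hx u).symm.trans (hcrit u hw)
  obtain ⟨s, hs0, hs⟩ := exists_pencil_member_eq_smul hH (hj x) (hA0 x) (hF0 x) hxA hxF hFb hcrit'
    (Fin.succAbove_ne i 0) hc
  have hmem : ∀ z, H i' ⬝ᵥ z - c * (H i ⬝ᵥ z) = s * (A x ⬝ᵥ z) := fun z => by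
    rw [← smul_eq_mul s, ← smul_dotProduct, ← hs, sub_dotProduct, smul_dotProduct, smul_eq_mul]
  have hAE : ∀ l, ∀ᶠ y in 𝓝 x, A y ⬝ᵥ E l y = 0 := by
    intro l
    filter_upwards [hFj, hAν, hEe, hX.span_eq] with y h1 h2 h3 h4
    rw [← diffMk_mem_complexTangent_iff (hj y) (hA0 y) (hF0 y) h2 h1, h3 l, ← h4]
    exact Submodule.subset_span ⟨l, rfl⟩
  have hcomp : ∀ l, ∃ g' : EuclideanSpace ℝ (Fin (2 * n + 1)) →L[ℝ] ℂ,
      HasMFDerivAt (𝓡 (2 * n + 1)) 𝓘(ℝ, ℂ) (fun y =>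
        ((H i' ⬝ᵥ E l y) * (H i ⬝ᵥ F y) - (H i' ⬝ᵥ F y) * (H i ⬝ᵥ E l y)) / (H i ⬝ᵥ F y) ^ 2)
        x g' ∧ ∀ u ∈ crDistribution (2 * n + 1) j x,
          g' u = -(s * (A' u ⬝ᵥ E l x)) / (H i ⬝ᵥ F x) := by
    intro l
    obtain ⟨α', hα, hαu⟩ := hasMFDerivAt_dotProduct (hE l) (H i')
    obtain ⟨β', hβ, hβu⟩ := hasMFDerivAt_dotProduct hF (H i)
    obtain ⟨γ', hγ, hγu⟩ := hasMFDerivAt_dotProduct hF (H i')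
    obtain ⟨δ', hδ, hδu⟩ := hasMFDerivAt_dotProduct (hE l) (H i)
    obtain ⟨g', hg, hgu⟩ := exists_hasMFDerivAt_quotient hα hβ hγ hδ hβ0
      (sub_eq_zero.1 ((hmem _).trans (by rw [(hAE l).self_of_nhds, mul_zero]))) hc
    refine ⟨g', hg, fun u hu => ?_⟩
    have hAF : A x ⬝ᵥ F' u = 0 := by
      rw [← diffMk_mem_complexTangent_iff (hj x) (hA0 x) (hF0 x) hxA hxF, ← hFu]
      exact hu
    have h1 : γ' u = c * β' u := by
      rw [hγu, hβu]
      exact sub_eq_zero.1 ((hmem _).trans (by rw [hAF, mul_zero]))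
    rw [hgu u h1, hαu, hδu, hmem,
      eq_neg_of_add_eq_zero_right (dotProduct_deriv_eq_zero hA (hE l) (hAE l) u), mul_neg]
  choose g hg hgu using hcomp
  have hG : HasMFDerivAt (𝓡 (2 * n + 1)) 𝓘(ℝ, Fin k → Fin 1 → ℂ)
      (fun y => (jetInFrame (pencilMap H ∘ j)
        (fun l y => diff (2 * n + 1) (pencilMap H ∘ j) y (X l y)) x y).2.2) x
      (ContinuousLinearMap.pi fun l => ContinuousLinearMap.pi fun _ => g l) := by
    refine HasMFDerivAt.congr_of_eventuallyEq ?_ hjet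
    refine ⟨continuousAt_pi.2 fun l => continuousAt_pi.2 fun _ => (hg l).continuousAt, ?_⟩
    exact HasFDerivAt.hasFDerivWithinAt (hasFDerivAt_pi.2 fun l => hasFDerivAt_pi.2 fun _ =>
      (hg l).hasFDerivAt_comp_symm)
  refine jetTransverseAlong_of_surjective hφ hG ?_
  -- The derivative of the linear part is injective on `D`.
  set G' : EuclideanSpace ℝ (Fin (2 * n + 1)) →L[ℝ] (Fin k → Fin 1 → ℂ) :=
    ContinuousLinearMap.pi fun l => ContinuousLinearMap.pi fun _ => g l with hG'
  have hinj : ∀ u ∈ crDistribution (2 * n + 1) j x, G' u = 0 → u = 0 := by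
    intro u hu h0
    have hAE' : ∀ l, A' u ⬝ᵥ E l x = 0 := by
      intro l
      have h1 : g l u = 0 := congrFun (congrFun h0 l) 0
      rw [hgu l u hu, div_eq_zero_iff, or_iff_left hβ0, neg_eq_zero, mul_eq_zero,
        or_iff_right hs0] at h1
      exact h1
    have hAF' : A' u ⬝ᵥ F x = 0 := dotProduct_deriv_lift_eq_zero hj hF hF0 hFj hA hA0 hAν hu
    -- `F x` and the `E l x` span the hyperplane `A x`, so `A' u` is a multiple of `A x`.
    have hspan : A' u ∈ Submodule.span ℂ {A x} := by
      refine mem_span_singleton_of_dotProduct fun z hz => ?_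
      rw [← diffMk_mem_complexTangent_iff (hj x) (hA0 x) (hF0 x) hxA hxF,
        ← hX.span_eq.self_of_nhds, Submodule.mem_span_range_iff_exists_fun] at hz
      obtain ⟨b, hb⟩ := hz
      have h1 : CP.diffMk (F x) (z - ∑ l, b l • E l x) = 0 := by
        rw [map_sub, map_sum, ← hb, sub_eq_zero]
        exact Finset.sum_congr rfl fun l _ => by rw [map_smul, hEe.self_of_nhds l]
      rw [CP.diffMk_eq_zero_iff (hF0 x), Submodule.mem_span_singleton] at h1
      obtain ⟨t, ht⟩ := h1
      rw [← sub_add_cancel z (∑ l, b l • E l x), ← ht, dotProduct_add, dotProduct_smul, hAF',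
        smul_zero, zero_add, dotProduct_sum]
      exact Finset.sum_eq_zero fun l _ => by rw [dotProduct_smul, hAE', smul_zero]
    rw [← CP.diffMk_eq_zero_iff (hA0 x), ← hAu] at hspan
    exact hν (hspan.trans (map_zero _).symm)
  -- Its source and target both have real dimension `2 n`.
  have hk : k = n := by
    have h1 := finrank_span_eq_card hX.linearIndependent.self_of_nhds
    rw [hX.span_eq.self_of_nhds, finrank_complexTangent (hj x), Fintype.card_fin] at h1
    exact h1.symm
  have hinj' : Function.Injective
      (G'.toLinearMap.domRestrict (crDistribution (2 * n + 1) j x)) := by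
    rw [← LinearMap.ker_eq_bot, LinearMap.ker_eq_bot']
    exact fun u hu => Subtype.ext (hinj u.1 u.2 hu)
  have hsurj := (LinearMap.injective_iff_surjective_of_finrank_eq_finrank (by
    rw [finrank_crDistribution (hj x)]
    simp [Module.finrank_pi_fintype, hk, mul_comm])).1 hinj'
  intro w
  obtain ⟨u, hu⟩ := hsurj w
  exact ⟨u.1, u.2, hu⟩

end

end CRPencil

end

theorem mainTheorem9 (n : ℕ) (M : Type*) [TopologicalSpace M]
    [ChartedSpace (EuclideanSpace ℝ (Fin (2 * n + 1))) M] [IsManifold (𝓡 (2 * n + 1)) 2 M]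
    [CompactSpace M] (j : M → CP (n + 1)) (hj : CRPencil.IsHypersurfaceEmbedding j)
    (hdual : CRPencil.HasImmersedDualSet j)
    (H : Fin 2 → Fin (n + 1 + 1) → ℂ) (hH : LinearIndependent ℂ H) :
    CRPencil.IsCRLefschetzPencil j H ↔ CRPencil.MeetsDualSetTransversely j H := by
  have hji := hj.injective_diff
  constructor
  · rintro h _ ⟨ha, -⟩ x rfl
    refine (CRPencil.dual_transverse_iff hji (hdual x)).2 fun hB => ?_
    exact (CRPencil.base_transverse_iff (hji x)).1 (h.base x hB) ha
  · intro h
    refine ⟨fun a ha b hb hab => ⟨?_, fun z _ => CRPencil.tangentLin_hyperplane_sup hab z⟩,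
      fun x hx => ?_, fun x hx hcrit k X hX => ?_, fun x hx hcrit => ?_⟩
    · rw [← CRPencil.hyperplane_inf_hyperplane hH ha hb hab]
      rfl
    · refine (CRPencil.base_transverse_iff (hji x)).2 fun ha => ?_
      exact (CRPencil.dual_transverse_iff hji (hdual x)).1 (h _ ⟨ha, x, rfl⟩ x rfl) hx
    · exact CRPencil.jetTransverseAlong_crDistribution hH hji (hdual x) hx hcrit hX
    -- Away from the base locus the pencil map has no critical point along the complex envelope.
    · obtain ⟨w, hw⟩ := CRPencil.exists_diffPencilMap_ne_zero hH hx
      refine absurd (hcrit w ?_) hw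
      rw [CRPencil.complexEnvelope_eq_top (hji x)]
      trivial
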